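/- Let $F$ be an absolutely continuous probability distribution on $[0,1]$ with mean $m^\varnothing$, let $k>0$ be a search cost and $n\ge 1$ a number of brokers. In each period in which an agent is still searching, he pays $k$ and samples a good whose quality is drawn from $F$, independently across periods, and is observed by nobody. Each broker $i\in\{1,\dots,n\}$ offers a price $p_i\ge 0$ and a signal $G_i$, where a signal is the distribution of a posterior mean, i.e. a mean-preserving contraction of $F$. The agent buys from one broker or takes the null offer (price $0$, with the signal degenerate at $m^\varnothing$). The posterior mean is drawn from the chosen signal and publicly observed, and the agent either consumes the good and stops, which ends the game, or continues to the next period (without recall). Histories record all past offers, purchase decisions and posterior means. Strategies are behavioral strategies (measurable in the history), and brokers randomize independently. There is no discounting: a broker's payoff is the expected sum of the prices paid to her, and the agent's payoff is the expected quality of the consumed good minus the expected sum of all search costs and prices paid. An equilibrium is a strategy profile that is sequentially rational: no player has a profitable deviation at any decision point, on or off the path of play. Let $\mathcal E(n,k)\subseteq\mathbb R^{n+1}$ be the set of equilibrium payoff profiles $y=(y_1,\dots,y_{n+1})$, where the last coordinate is the agent's payoff. Let $\underline u_k=m^\varnothing-k$, let $\bar u_k$ be the solution $u$ of $k=\int\max\{\theta-u,0\}\,dF(\theta)$,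 and define the set of feasible payoff profiles $$\mathcal F(n,k)=\Big\{y\in\mathbb R^{n+1}_+ : y_{n+1}\ge \underline u_k,\ \sum_{j=1}^{n+1}y_j\le \bar u_k\Big\}$$ and, for $\epsilon>0$, $\mathcal F^\epsilon(n,k)=\{y\in\mathcal F(n,k):\sum_{i=1}^n y_i\le\epsilon\}$. Let $k^*$ be the monopoly threshold, i.e. the supremum of all $\kappa\in(0,m^\varnothing)$ such that $\mathcal E(1,k)=\mathcal F(1,k)$ for every $k\in(0,\kappa]$. Then there exist $k^{**}\in(k^*,m^\varnothing)$ and $\epsilon>0$ such that for all $k\in(0,k^{**}]$ and all $n>1$, $$\mathcal F^\epsilon(n,k)\subseteq\mathcal E(n,k),$$ and $\mathcal F^\epsilon(n,k)$ has non-empty interior in $\mathbb R^{n+1}$. -/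

import Mathlib

open MeasureTheory ProbabilityTheory
open scoped NNReal ENNReal

noncomputable section

namespace PersuadedSearch

/-! ### Search environment

Qualities and posterior means are points of the unit interval `[0,1]`; the quality
distribution is a probability measure `F` on it. -/

/-- The prior mean of the quality distribution. -/
def priorMean (F : Measure unitInterval) : ℝ := ∫ θ, (θ : ℝ) ∂F

/-- The expected gain, over the outside value `u`, from one perfectly observed quality. -/
def searchGain (F : Measure unitInterval) (u : ℝ) : ℝ := ∫ θ, max ((θ : ℝ) - u) 0 ∂F

/-- The agent's payoff from searching without information. -/
def autarkyPayoff (F : Measure unitInterval) (k : ℝ) : ℝ := priorMean F - k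

/-- The agent's payoff from searching with free full information: the solution `u` of
`k = ∫ (θ - u)⁺ dF(θ)`.  For `k > 0` the solution set is a singleton. -/
def mcCallPayoff (F : Measure unitInterval) (k : ℝ) : ℝ := sSup {u : ℝ | searchGain F u = k}

/-! ### Signals and offers -/

/-- `G` is a mean-preserving contraction of `F`: it is dominated by `F` in the convex order. -/
def IsMeanPreservingContraction (F G : Measure unitInterval) : Prop :=
  IsProbabilityMeasure G ∧
    ∀ φ : ℝ → ℝ, ConvexOn ℝ Set.univ φ → ∫ m, φ (m : ℝ) ∂G ≤ ∫ θ, φ (θ : ℝ) ∂F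

/-- The posterior-mean distributions that are feasible under `F`. -/
abbrev Signal (F : Measure unitInterval) : Type :=
  {G : Measure unitInterval // IsMeanPreservingContraction F G}

/-- A take-it-or-leave-it offer: a nonnegative price and a feasible signal. -/
abbrev Offer (F : Measure unitInterval) : Type := ℝ≥0 × Signal F

/-- A purchase decision: `some i` is a purchase from broker `i`, `none` is the null offer. -/
abbrev Choice (n : ℕ) : Type := Option (Fin n)

instance instMeasurableSpaceChoice (n : ℕ) : MeasurableSpace (Choice n) := ⊤

theorem priorMean_mem (F : Measure unitInterval) [IsProbabilityMeasure F] :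
    priorMean F ∈ unitInterval := by
  have hint : Integrable (fun θ : unitInterval => (θ : ℝ)) F :=
    Integrable.of_bound (C := 1) measurable_subtype_coe.aestronglyMeasurable
      (Filter.Eventually.of_forall fun θ => by
        rw [Real.norm_eq_abs, abs_of_nonneg θ.2.1]; exact θ.2.2)
  refine ⟨integral_nonneg fun θ => θ.2.1, ?_⟩
  have h := integral_mono hint (integrable_const (1 : ℝ)) (fun θ => θ.2.2)
  simpa [priorMean] using h

/-- The price paid under a purchase decision; the null offer is free. -/
def price {F : Measure unitInterval} {n : ℕ} (O : Fin n → Offer F) (w : Choice n) : ℝ≥0 :=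
  match w with
  | none => 0
  | some i => (O i).1

/-- The distribution of the posterior mean under a purchase decision; the null offer is
uninformative, so that the posterior mean is the prior mean. -/
def signal {F : Measure unitInterval} [IsProbabilityMeasure F] {n : ℕ} (O : Fin n → Offer F)
    (w : Choice n) : Measure unitInterval :=
  match w with
  | none => Measure.dirac ⟨priorMean F, priorMean_mem F⟩
  | some i => ((O i).2 : Measure unitInterval)

/-! ### Histories and strategies -/

/-- The public record of a period: offers, purchase decision, realized posterior mean. -/
abbrev Stage (F : Measure unitInterval) (n : ℕ) : Type :=
  (Fin n → Offer F) × Choice n × unitInterval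

/-- Histories of `t` past periods (in all of which the agent continued searching). -/
abbrev History (F : Measure unitInterval) (n t : ℕ) : Type := Fin t → Stage F n

/-- The empty history. -/
def emptyHistory (F : Measure unitInterval) (n : ℕ) : History F n 0 := fun i => i.elim0

/-- The history `h` followed by the record `s` of one more period. -/
def extend {F : Measure unitInterval} {n t : ℕ} (h : History F n t) (s : Stage F n) :
    History F n (t + 1) :=
  Fin.snoc (α := fun _ => Stage F n) h s

/-- A behavioral strategy of a broker. -/
structure BrokerStrategy (F : Measure unitInterval) (n : ℕ) where
  /-- the distribution of the offer made after each history -/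
  offer : ∀ t, Kernel (History F n t) (Offer F)
  markov : ∀ t, IsMarkovKernel (offer t)

/-- A behavioral strategy of the agent. -/
structure AgentStrategy (F : Measure unitInterval) (n : ℕ) where
  /-- the distribution of the purchase decision, given the history and the current offers -/
  buy : ∀ t, History F n t → (Fin n → Offer F) → PMF (Choice n)
  measurable_buy : ∀ t w,
    Measurable fun x : History F n t × (Fin n → Offer F) => buy t x.1 x.2 w
  /-- the probability of continuing to search, given the history and the current record -/
  cont : ∀ t, History F n t → Stage F n → unitInterval
  measurable_cont : ∀ t, Measurable fun x : History F n t × Stage F n => cont t x.1 x.2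

/-- A strategy profile. -/
structure Profile (F : Measure unitInterval) (n : ℕ) where
  broker : Fin n → BrokerStrategy F n
  agent : AgentStrategy F n

/-- The profile in which broker `i` deviates to `τ`. -/
def Profile.deviateBroker {F : Measure unitInterval} {n : ℕ} (σ : Profile F n) (i : Fin n)
    (τ : BrokerStrategy F n) : Profile F n :=
  { σ with broker := Function.update σ.broker i τ }

/-- The profile in which the agent deviates to `τ`. -/
def Profile.deviateAgent {F : Measure unitInterval} {n : ℕ} (σ : Profile F n)
    (τ : AgentStrategy F n) : Profile F n :=
  { σ with agent := τ }

/-! ### Expected payoffs -/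

section Payoffs

variable {F : Measure unitInterval} [IsProbabilityMeasure F] {n : ℕ}

/-- The law of the offers made after the history `h`; brokers randomize independently. -/
def offerLaw (σ : Profile F n) (t : ℕ) (h : History F n t) : Measure (Fin n → Offer F) :=
  Measure.pi fun i => (σ.broker i).offer t h

/-- The expectation of `g` over the current record, after the history `h` and offers `O`. -/
def expectStage (σ : Profile F n) (t : ℕ) (h : History F n t) (O : Fin n → Offer F)
    (g : Stage F n → ℝ≥0∞) : ℝ≥0∞ :=
  ∑ w : Choice n, σ.agent.buy t h O w * ∫⁻ m, g (O, w, m) ∂(signal O w)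

/-- The probability of continuing, as an extended nonnegative real. -/
def contProb (σ : Profile F n) (t : ℕ) (h : History F n t) (s : Stage F n) : ℝ≥0∞ :=
  ENNReal.ofReal (σ.agent.cont t h s : ℝ)

/-- The probability of stopping, as an extended nonnegative real. -/
def stopProb (σ : Profile F n) (t : ℕ) (h : History F n t) (s : Stage F n) : ℝ≥0∞ :=
  ENNReal.ofReal (1 - (σ.agent.cont t h s : ℝ))

/-- Let `c` be a nonnegative amount that accrues in every period in which the agent is still
searching.  This is the expectation, in the play of `σ` that starts from the history `h`, of the
sum of what accrues in the next `N` periods, up to the period in which the agent stops. -/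
def expectedSum (σ : Profile F n) (c : ∀ t, History F n t → Stage F n → ℝ≥0∞) :
    ℕ → ∀ t, History F n t → ℝ≥0∞
  | 0, _, _ => 0
  | N + 1, t, h => ∫⁻ O, expectStage σ t h O
      (fun s => c t h s + contProb σ t h s * expectedSum σ c N (t + 1) (extend h s))
      ∂(offerLaw σ t h)

/-- The expectation of the whole sum of what accrues until the agent stops (possibly never):
by monotone convergence, the limit of the expectations over finitely many periods. -/
def expectedTotal (σ : Profile F n) (c : ∀ t, History F n t → Stage F n → ℝ≥0∞)
    (t : ℕ) (h : History F n t) : ℝ≥0∞ :=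
  ⨆ N, expectedSum σ c N t h

/-- The same expectation, conditional on the record `s` of the current period, before the
agent's stopping decision. -/
def totalAfterStage (σ : Profile F n) (c : ∀ t, History F n t → Stage F n → ℝ≥0∞)
    (t : ℕ) (h : History F n t) (s : Stage F n) : ℝ≥0∞ :=
  c t h s + contProb σ t h s * expectedTotal σ c (t + 1) (extend h s)

/-- The same expectation, conditional on the offers `O` of the current period, before the agent's
purchase decision. -/
def totalAfterOffers (σ : Profile F n) (c : ∀ t, History F n t → Stage F n → ℝ≥0∞)
    (t : ℕ) (h : History F n t) (O : Fin n → Offer F) : ℝ≥0∞ :=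
  expectStage σ t h O (totalAfterStage σ c t h)

/-- What broker `i` is paid in a period. -/
def revenue (i : Fin n) (s : Stage F n) : ℝ≥0∞ :=
  if s.2.1 = some i then ((s.1 i).1 : ℝ≥0∞) else 0

/-- What the agent spends in a period: the search cost and the price of the signal. -/
def expense (k : ℝ) (s : Stage F n) : ℝ≥0∞ :=
  ENNReal.ofReal k + (price s.1 s.2.1 : ℝ≥0∞)

/-- The agent's expected consumption value in a period: if he stops, he consumes a good whose
expected quality, given the signal realization, is the realized posterior mean. -/
def consumption (σ : Profile F n) (t : ℕ) (h : History F n t) (s : Stage F n) : ℝ≥0∞ :=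
  stopProb σ t h s * ENNReal.ofReal (s.2.2 : ℝ)

/-- Broker `i`'s expected payoff after the history `h`. -/
def brokerPayoff (σ : Profile F n) (i : Fin n) (t : ℕ) (h : History F n t) : ℝ≥0∞ :=
  expectedTotal σ (fun _ _ => revenue i) t h

/-- The agent's expected payoff after the history `h`, at the beginning of a period.  The expected
consumption is at most one; the payoff is `-∞` if the expected expenses are infinite. -/
def agentPayoff (k : ℝ) (σ : Profile F n) (t : ℕ) (h : History F n t) : EReal :=
  (expectedTotal σ (consumption σ) t h : EReal) -
    (expectedTotal σ (fun _ _ => expense k) t h : EReal)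

/-- The agent's expected payoff when he is about to choose an offer from `O`. -/
def agentPayoffAfterOffers (k : ℝ) (σ : Profile F n) (t : ℕ) (h : History F n t)
    (O : Fin n → Offer F) : EReal :=
  (totalAfterOffers σ (consumption σ) t h O : EReal) -
    (totalAfterOffers σ (fun _ _ => expense k) t h O : EReal)

/-- The agent's expected payoff when he is about to decide whether to stop (including the current,
already sunk, expenses). -/
def agentPayoffAfterStage (k : ℝ) (σ : Profile F n) (t : ℕ) (h : History F n t)
    (s : Stage F n) : EReal :=
  (totalAfterStage σ (consumption σ) t h s : EReal) -
    (totalAfterStage σ (fun _ _ => expense k) t h s : EReal)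

/-! ### Equilibrium and payoff sets -/

/-- Sequential rationality: no player has a profitable deviation at any of his decision points,
on or off the path of play. -/
structure IsEquilibrium (k : ℝ) (σ : Profile F n) : Prop where
  broker_optimal : ∀ (i : Fin n) (τ : BrokerStrategy F n) (t : ℕ) (h : History F n t),
    brokerPayoff (σ.deviateBroker i τ) i t h ≤ brokerPayoff σ i t h
  agent_optimal : ∀ (τ : AgentStrategy F n) (t : ℕ) (h : History F n t),
    agentPayoff k (σ.deviateAgent τ) t h ≤ agentPayoff k σ t h
  agent_optimal_buy : ∀ (τ : AgentStrategy F n) (t : ℕ) (h : History F n t)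
    (O : Fin n → Offer F),
    agentPayoffAfterOffers k (σ.deviateAgent τ) t h O ≤ agentPayoffAfterOffers k σ t h O
  agent_optimal_stop : ∀ (τ : AgentStrategy F n) (t : ℕ) (h : History F n t) (s : Stage F n),
    agentPayoffAfterStage k (σ.deviateAgent τ) t h s ≤ agentPayoffAfterStage k σ t h s

end Payoffs

/-- The set of equilibrium payoff profiles with `n` brokers and search cost `k`; the first `n`
coordinates belong to the brokers and the last one to the agent. -/
def equilibriumPayoffs (F : Measure unitInterval) [IsProbabilityMeasure F] (n : ℕ) (k : ℝ) :
    Set (Fin (n + 1) → ℝ) :=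
  {y | ∃ σ : Profile F n, IsEquilibrium k σ ∧
    (∀ i : Fin n, (brokerPayoff σ i 0 (emptyHistory F n) : EReal) = (y i.castSucc : EReal)) ∧
    agentPayoff k σ 0 (emptyHistory F n) = (y (Fin.last n) : EReal)}

/-- The set of feasible payoff profiles. -/
def feasiblePayoffs (F : Measure unitInterval) (n : ℕ) (k : ℝ) : Set (Fin (n + 1) → ℝ) :=
  {y | (∀ j, 0 ≤ y j) ∧ autarkyPayoff F k ≤ y (Fin.last n) ∧ ∑ j, y j ≤ mcCallPayoff F k}

/-- The feasible payoff profiles in which the brokers' total payoff is at most `ε`. -/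
def feasiblePayoffsWithin (F : Measure unitInterval) (n : ℕ) (k ε : ℝ) : Set (Fin (n + 1) → ℝ) :=
  {y | y ∈ feasiblePayoffs F n k ∧ ∑ i : Fin n, y i.castSucc ≤ ε}

/-- The monopoly threshold: the largest search cost up to which every feasible payoff profile is
an equilibrium payoff profile when there is a single broker. -/
def monopolyThreshold (F : Measure unitInterval) [IsProbabilityMeasure F] : ℝ :=
  sSup {κ : ℝ | 0 < κ ∧ κ < priorMean F ∧
    ∀ k : ℝ, 0 < k → k ≤ κ → equilibriumPayoffs F 1 k = feasiblePayoffs F 1 k}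

end PersuadedSearch

end

/-! Write μ for the prior mean, g for `searchGain F` and c for `mcCallPayoff F k`. A signal G
followed by a continuation worth u has gross value `optionValue u G`, which is at most u + g(u),
with equality for full information.

With at least two brokers, a deviator is deterred by letting the agent buy from a rival. That
purchase is rewarded with free full information ever after, worth c, while buying from the deviator,
or nothing, leads to a continuation worth μ - k. So even a free deviating offer is worth at most μ -
k + g(μ - k). The standing signal has to beat this when followed by c, and yet, in the punishment
phase itself, leave the agent with only μ - k. `exists_rare_disclosure` provides a signal R that
does both: it discloses qualities above c so rarely that every other realization stays at or above μ
- k. Followed by μ - k it is worth exactly μ; followed by c it is worth at least c + k * g(c) = c +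
k ^ 2. Deviations therefore fail as soon as μ - k + g(μ - k) plus the fee is below c + k ^ 2.

A single broker can be refused only through the null offer, worth at most max(μ, c). If she may earn
nothing in equilibrium, then μ - k + g(μ - k) ≤ max(μ, c) (`le_of_equilibriumPayoffs_eq`). Hence up
to the monopoly threshold competing brokers are deterred with k ^ 2 to spare, and by continuity of c
this slack survives a little beyond the threshold. Near k = 0, where k ^ 2 vanishes, the slack comes
from c approaching the top of the support of F. `exists_cost_bound` combines the two into one margin
δ, and every ε < δ serves.

Each payoff profile is then realized by a `Scheme`: fees are paid in the first period only, a
lottery splits them among the brokers, and `exists_signal_threshold` tunes the agent's gross value.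
Optimality is verified by one-step inequalities for a candidate value function; the positive search
cost makes the truncation error vanish. -/

noncomputable section

namespace PersuadedSearch

/-! ### The gain from search -/

section Gain

variable {F : Measure unitInterval}

theorem integrable_of_continuous [IsFiniteMeasure F] {f : unitInterval → ℝ} (hf : Continuous f) :
    Integrable f F := by
  obtain ⟨C, hC⟩ := isCompact_univ.exists_bound_of_continuousOn hf.continuousOn
  exact Integrable.of_bound hf.aestronglyMeasurable C
    (Filter.Eventually.of_forall fun x => hC x (Set.mem_univ x))

theorem integrable_gain [IsFiniteMeasure F] (u : ℝ) :
    Integrable (fun θ : unitInterval => max ((θ : ℝ) - u) 0) F :=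
  integrable_of_continuous (by fun_prop)

theorem integrable_coe [IsFiniteMeasure F] : Integrable (fun θ : unitInterval => (θ : ℝ)) F :=
  integrable_of_continuous (by fun_prop)

variable [IsProbabilityMeasure F]

theorem integral_max_eq (u : ℝ) :
    ∫ θ : unitInterval, max (θ : ℝ) u ∂F = u + searchGain F u := by
  have h : ∀ θ : unitInterval, max (θ : ℝ) u = u + max ((θ : ℝ) - u) 0 := fun θ => by
    rcases le_total (θ : ℝ) u with h | h
    · rw [max_eq_right h, max_eq_right (by linarith)]; ring
    · rw [max_eq_left h, max_eq_left (by linarith)]; ring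
  simp_rw [h]
  rw [integral_add (integrable_const _) (integrable_gain u)]
  simp [searchGain]

theorem priorMean_sub_le_searchGain (u : ℝ) : priorMean F - u ≤ searchGain F u := by
  have : ∫ θ : unitInterval, ((θ : ℝ) - u) ∂F = priorMean F - u := by
    rw [integral_sub integrable_coe (integrable_const _)]; simp [priorMean]
  rw [← this]
  exact integral_mono (integrable_coe.sub (integrable_const _)) (integrable_gain u)
    fun θ => le_max_left _ _

theorem searchGain_antitone : Antitone (searchGain F) := fun u v h =>
  integral_mono (integrable_gain v) (integrable_gain u) fun θ => by
    simp only; gcongr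

theorem searchGain_le_add {u v : ℝ} (h : u ≤ v) :
    searchGain F u ≤ searchGain F v + (v - u) := by
  have : ∫ θ : unitInterval, (max ((θ : ℝ) - v) 0 + (v - u)) ∂F = searchGain F v + (v - u) := by
    rw [integral_add (integrable_gain v) (integrable_const _)]; simp [searchGain]
  rw [← this]
  refine integral_mono (integrable_gain u) ((integrable_gain v).add (integrable_const _)) fun θ => ?_
  simp only
  rcases le_total ((θ : ℝ) - u) 0 with h1 | h1
  · rw [max_eq_right h1]; have := le_max_right ((θ : ℝ) - v) 0; linarith
  · rw [max_eq_left h1]; have := le_max_left ((θ : ℝ) - v) 0; linarith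

/-- Strict monotonicity of the gain where it is positive, in quantitative form. -/
theorem searchGain_add_mul_le {u v : ℝ} (h : u ≤ v) (hv : 0 ≤ v) :
    searchGain F v + (v - u) * searchGain F v ≤ searchGain F u := by
  have : ∫ θ : unitInterval, (max ((θ : ℝ) - v) 0 + (v - u) * max ((θ : ℝ) - v) 0) ∂F
      = searchGain F v + (v - u) * searchGain F v := by
    rw [integral_add (integrable_gain v) ((integrable_gain v).const_mul _), integral_const_mul]
    rfl
  rw [← this]
  refine integral_mono ((integrable_gain v).add ((integrable_gain v).const_mul _))
    (integrable_gain u) fun θ => ?_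
  simp only
  -- Since v ≥ 0, the excess θ - v is at most one, so the extra gain v - u, earned wherever θ ≥ v,
  -- is at least (v - u) * (θ - v).
  have hθ := θ.2.2
  rcases le_total ((θ : ℝ) - v) 0 with h1 | h1
  · rw [max_eq_right h1]; simp
  · rw [max_eq_left h1, max_eq_left (by linarith)]
    nlinarith

omit [IsProbabilityMeasure F] in
theorem searchGain_one : searchGain F 1 = 0 := by
  have : ∀ θ : unitInterval, max ((θ : ℝ) - 1) 0 = 0 := fun θ =>
    max_eq_right (by linarith [θ.2.2])
  simp [searchGain, this]

omit [IsProbabilityMeasure F] in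
theorem searchGain_nonneg (u : ℝ) : 0 ≤ searchGain F u :=
  integral_nonneg fun _ => le_max_right _ _

theorem continuous_searchGain : Continuous (searchGain F) := by
  refine (LipschitzWith.of_le_add_mul 1 fun u v => ?_).continuous
  simp only [NNReal.coe_one, one_mul]
  rcases le_total u v with h | h
  · have := searchGain_le_add (F := F) h
    rw [dist_comm, Real.dist_eq, abs_of_nonneg (by linarith)]; linarith
  · exact (searchGain_antitone h).trans (by linarith [dist_nonneg (x := u) (y := v)])

theorem searchGain_priorMean_le : searchGain F (priorMean F) ≤ priorMean F := by
  have h := (priorMean_mem F).1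
  calc searchGain F (priorMean F) ≤ searchGain F 0 := searchGain_antitone h
    _ = priorMean F := by
      unfold searchGain priorMean
      exact integral_congr_ae (Filter.Eventually.of_forall fun θ => by
        simp only; rw [max_eq_left (by linarith [θ.2.1]), sub_zero])

/-! ### The payoff from search with free full information -/

variable {k : ℝ}

theorem existsUnique_searchGain_eq (hk : 0 < k) (hk' : k < priorMean F) :
    ∃ u, searchGain F u = k ∧ priorMean F - k ≤ u ∧ u ≤ 1 ∧ ∀ v, searchGain F v = k → v = u := by
  have h1 := (priorMean_mem F).2
  have hivt := intermediate_value_Icc' (show priorMean F - k ≤ 1 by linarith)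
    (continuous_searchGain (F := F)).continuousOn
  have hmem : k ∈ Set.Icc (searchGain F 1) (searchGain F (priorMean F - k)) := by
    rw [searchGain_one]
    exact ⟨hk.le, by have := priorMean_sub_le_searchGain (F := F) (priorMean F - k); linarith⟩
  obtain ⟨u, hu, hgu⟩ := hivt hmem
  refine ⟨u, hgu, hu.1, hu.2, fun v hv => ?_⟩
  -- Every solution is at least μ - k > 0, where the quantitative strict monotonicity applies.
  have key : ∀ a b : ℝ, a < b → searchGain F a = k → searchGain F b = k → False := by
    intro a b hab ha hb
    have hb0 : 0 ≤ b := by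
      have := priorMean_sub_le_searchGain (F := F) b
      linarith
    have := searchGain_add_mul_le (F := F) hab.le hb0
    rw [ha, hb] at this
    nlinarith
  rcases lt_trichotomy v u with h | h | h
  · exact (key v u h hv hgu).elim
  · exact h
  · exact (key u v h hgu hv).elim

theorem mcCallPayoff_spec (hk : 0 < k) (hk' : k < priorMean F) :
    searchGain F (mcCallPayoff F k) = k ∧ priorMean F - k ≤ mcCallPayoff F k ∧
      mcCallPayoff F k ≤ 1 := by
  obtain ⟨u, h1, h2, h3, h4⟩ := existsUnique_searchGain_eq hk hk'
  have : {v | searchGain F v = k} = {u} := Set.ext fun v => ⟨h4 v, fun h => by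
    rw [Set.mem_singleton_iff] at h; subst h; exact h1⟩
  rw [mcCallPayoff, this, csSup_singleton]
  exact ⟨h1, h2, h3⟩

theorem le_mcCallPayoff (hk : 0 < k) (hk' : k < priorMean F) {u : ℝ} (hu : k ≤ searchGain F u) :
    u ≤ mcCallPayoff F k := by
  obtain ⟨h1, h2, -⟩ := mcCallPayoff_spec hk hk'
  by_contra! h
  have := searchGain_add_mul_le (F := F) h.le (by linarith)
  nlinarith

theorem mcCallPayoff_le (hk : 0 < k) (hk' : k < priorMean F) {u : ℝ} (hu : searchGain F u ≤ k) :
    mcCallPayoff F k ≤ u := by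
  obtain ⟨h1, h2, -⟩ := mcCallPayoff_spec hk hk'
  by_contra! h
  have := searchGain_add_mul_le (F := F) h.le (by linarith)
  rw [h1] at this
  nlinarith

/-- Between the two solutions the gain drops by l - k, and by `searchGain_add_mul_le` it drops at
rate at least k. This is the continuity of c in the cost. -/
theorem mcCallPayoff_le_add {l : ℝ} (hk : 0 < k) (hkl : k ≤ l) (hl : l < priorMean F) :
    mcCallPayoff F k ≤ mcCallPayoff F l + (l - k) / k := by
  obtain ⟨h1, h2, -⟩ := mcCallPayoff_spec hk (hkl.trans_lt hl)
  obtain ⟨h3, h4, -⟩ := mcCallPayoff_spec (hk.trans_le hkl) hl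
  have h5 : mcCallPayoff F l ≤ mcCallPayoff F k :=
    le_mcCallPayoff hk (hkl.trans_lt hl) (h3.symm ▸ hkl)
  have := searchGain_add_mul_le (F := F) h5 (by linarith)
  rw [h1, h3] at this
  have : mcCallPayoff F k - mcCallPayoff F l ≤ (l - k) / k := by
    rw [le_div_iff₀ hk]; linarith
  linarith

/-! ### Consequences of absolute continuity -/

omit [IsProbabilityMeasure F] in
theorem measure_singleton_of_absolutelyContinuous (hF : F ≪ volume) (x : unitInterval) :
    F {x} = 0 := hF (measure_singleton x)

theorem not_ae_eq_const (hF : F ≪ volume) (c : ℝ) : ¬ ∀ᵐ θ ∂F, (θ : unitInterval).1 = c := by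
  intro h
  have hne : F ≠ 0 := IsProbabilityMeasure.ne_zero F
  have : (ae F).NeBot := ae_neBot.2 hne
  obtain ⟨x, hx⟩ := h.exists
  have h0 : F {x} = 0 := measure_singleton_of_absolutelyContinuous hF x
  have h1 : ∀ᵐ θ ∂F, θ ∈ ({x} : Set unitInterval) := by
    filter_upwards [h] with θ hθ
    exact Subtype.ext (hθ.trans hx.symm)
  have h2 : F {x}ᶜ = 0 := h1
  have h3 : F Set.univ = 0 := by
    rw [← Set.union_compl_self ({x} : Set unitInterval)]
    exact measure_union_null h0 h2
  simp at h3

/-- A continuous function that lies on one side of its expectation is almost surely constant. -/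
theorem ae_eq_of_le_integral {f : unitInterval → ℝ} (hf : Continuous f) {c : ℝ}
    (hle : ∀ᵐ θ ∂F, f θ ≤ c) (hc : c ≤ ∫ θ, f θ ∂F) : ∀ᵐ θ ∂F, f θ = c := by
  have hi : Integrable (fun θ => c - f θ) F := integrable_of_continuous (by fun_prop)
  have h0 : 0 ≤ᵐ[F] fun θ => c - f θ := by
    filter_upwards [hle] with θ hθ
    simp only [Pi.zero_apply]; linarith
  have hint : ∫ θ, (c - f θ) ∂F = 0 := by
    refine le_antisymm ?_ (integral_nonneg_of_ae h0)
    rw [integral_sub (integrable_const _) (integrable_of_continuous hf)]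
    simp; linarith
  rw [integral_eq_zero_iff_of_nonneg_ae h0 hi] at hint
  filter_upwards [hint] with θ hθ
  simp only [Pi.zero_apply] at hθ; linarith

theorem ae_le_of_searchGain_eq_zero {u : ℝ} (h : searchGain F u = 0) :
    ∀ᵐ θ ∂F, (θ : unitInterval).1 ≤ u := by
  have h0 := (integral_eq_zero_iff_of_nonneg (f := fun θ : unitInterval => max ((θ : ℝ) - u) 0)
    (fun _ => le_max_right _ _) (integrable_gain u)).1 h
  filter_upwards [h0] with θ hθ
  simp only [Pi.zero_apply] at hθ
  have := le_max_left ((θ : ℝ) - u) 0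
  linarith

theorem searchGain_priorMean_pos (hF : F ≪ volume) : 0 < searchGain F (priorMean F) := by
  refine lt_of_le_of_ne (searchGain_nonneg _) fun h => ?_
  exact not_ae_eq_const hF _ (ae_eq_of_le_integral (f := fun θ => (θ : ℝ)) (by fun_prop)
    (ae_le_of_searchGain_eq_zero h.symm) le_rfl)

/-- Otherwise max(θ, μ) never exceeds its own mean, so it is almost surely that constant; the
constant lies above μ, so θ itself would be constant. Thus the support of F reaches above the value
of one full disclosure followed by μ. -/
theorem searchGain_add_priorMean_pos (hF : F ≪ volume) :
    0 < searchGain F (priorMean F + searchGain F (priorMean F)) := by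
  refine lt_of_le_of_ne (searchGain_nonneg _) fun h => ?_
  set M := priorMean F + searchGain F (priorMean F) with hM
  have hpos := searchGain_priorMean_pos hF
  have h1 := ae_eq_of_le_integral (F := F) (f := fun θ => max (θ : ℝ) (priorMean F)) (c := M)
    (by fun_prop) (by
      filter_upwards [ae_le_of_searchGain_eq_zero h.symm] with θ hθ
      exact max_le hθ (by linarith)) (by rw [integral_max_eq])
  refine not_ae_eq_const hF M ?_
  filter_upwards [h1] with θ hθ
  rcases max_choice (θ : ℝ) (priorMean F) with h2 | h2
  · rw [h2] at hθ; exact hθ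
  · rw [h2] at hθ; linarith

theorem searchGain_reflect (u : ℝ) :
    searchGain F u = priorMean F - u + ∫ θ : unitInterval, max (u - (θ : ℝ)) 0 ∂F := by
  have h : ∀ θ : unitInterval, max ((θ : ℝ) - u) 0 = ((θ : ℝ) - u) + max (u - (θ : ℝ)) 0 :=
    fun θ => by
      rcases le_total (θ : ℝ) u with h | h
      · rw [max_eq_right (by linarith), max_eq_left (by linarith)]; ring
      · rw [max_eq_left (by linarith), max_eq_right (by linarith)]; ring
  unfold searchGain
  simp_rw [h]
  rw [integral_add (integrable_of_continuous (by fun_prop)) (integrable_of_continuous (by fun_prop)),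
    integral_sub integrable_coe (integrable_const _)]
  simp [priorMean]

/-- With K = g(μ), equality would put no mass below μ - K. Then (μ - θ)⁺, whose mean is K by
reflection, would be bounded by K, hence constant, and so would θ. The lemma shows that at cost K a
monopolist's full information strictly beats refusal. -/
theorem lt_searchGain_sub (hF : F ≪ volume) :
    searchGain F (priorMean F) < searchGain F (priorMean F - searchGain F (priorMean F)) := by
  set K := searchGain F (priorMean F) with hK
  have hpos : 0 < K := searchGain_priorMean_pos hF
  rw [searchGain_reflect (priorMean F - K)]
  have h0 : 0 ≤ ∫ θ : unitInterval, max (priorMean F - K - (θ : ℝ)) 0 ∂F :=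
    integral_nonneg fun _ => le_max_right _ _
  rcases h0.lt_or_eq with h | h
  · linarith
  exfalso
  replace h := (integral_eq_zero_iff_of_nonneg
    (f := fun θ : unitInterval => max (priorMean F - K - (θ : ℝ)) 0)
    (fun _ => le_max_right _ _) (integrable_of_continuous (by fun_prop))).1 h.symm
  have hint : ∫ θ : unitInterval, max (priorMean F - (θ : ℝ)) 0 ∂F = K := by
    have := searchGain_reflect (F := F) (priorMean F)
    linarith
  have h1 := ae_eq_of_le_integral (F := F) (f := fun θ => max (priorMean F - (θ : ℝ)) 0) (c := K)
    (by fun_prop) (by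
      filter_upwards [h] with θ hθ
      simp only [Pi.zero_apply] at hθ
      have := le_max_left (priorMean F - K - (θ : ℝ)) 0
      exact max_le (by linarith) hpos.le) hint.ge
  refine not_ae_eq_const hF (priorMean F - K) ?_
  filter_upwards [h1] with θ hθ
  rcases max_choice (priorMean F - (θ : ℝ)) 0 with h2 | h2
  · rw [h2] at hθ; linarith
  · rw [h2] at hθ; linarith

/-- The search costs for which no single broker can be deterred from selling information. -/
theorem exists_cost_bound (hF : F ≪ volume) (S : Set ℝ)
    (hS : ∀ κ ∈ S, 0 < κ ∧ κ < priorMean F ∧ ∀ k, 0 < k → k ≤ κ →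
      priorMean F - k + searchGain F (priorMean F - k) ≤ max (priorMean F) (mcCallPayoff F k)) :
    ∃ kss, sSup S < kss ∧ kss < searchGain F (priorMean F) ∧ ∃ δ, 0 < δ ∧
      ∀ k, 0 < k → k ≤ kss →
        priorMean F - k + searchGain F (priorMean F - k) + δ ≤ mcCallPayoff F k + k ^ 2 := by
  set μ := priorMean F with hμ
  set g := searchGain F with hg
  set K := g μ with hK
  have hKpos : 0 < K := searchGain_priorMean_pos hF
  have hKμ : K ≤ μ := searchGain_priorMean_le
  -- small costs
  set u₀ := μ + K + g (μ + K) / 2 with hu₀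
  have hM : 0 < g (μ + K) := searchGain_add_priorMean_pos hF
  have hgu₀ : 0 < g u₀ := by
    have := searchGain_le_add (F := F) (show μ + K ≤ u₀ by linarith)
    simp only [← hg] at this
    linarith
  have hgu₀K : g u₀ ≤ K := searchGain_antitone (by linarith)
  set k₁ := g u₀ / 2 with hk₁
  have hk₁pos : 0 < k₁ := by positivity
  have hk₁K : k₁ < K := by linarith
  -- The left side without the margin is at most μ + K, whereas c is at least u₀ once k ≤ g(u₀).
  have hsmall : ∀ k, 0 < k → k ≤ k₁ → μ - k + g (μ - k) + g (μ + K) / 2 ≤ mcCallPayoff F k := by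
    intro k hk hkk
    have h1 : u₀ ≤ mcCallPayoff F k := le_mcCallPayoff hk (by linarith) (by linarith)
    have h2 := searchGain_le_add (F := F) (show μ - k ≤ μ by linarith)
    simp only [← hg, ← hK] at h2
    linarith
  -- continuity of the deterrence margin
  have hcont : ∀ k l, 0 < k → k ≤ l → l < K →
      mcCallPayoff F k - (μ - k + g (μ - k)) - (l - k) / k ≤
        mcCallPayoff F l - (μ - l + g (μ - l)) := by
    intro k l hk hkl hl
    have h1 := mcCallPayoff_le_add (F := F) hk hkl (by linarith)
    have h2 := searchGain_le_add (F := F) (show μ - l ≤ μ - k by linarith)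
    simp only [← hg] at h2
    linarith
  -- the threshold lies below `K`
  set τ := g (μ - K) - K with hτ
  have hτpos : 0 < τ := by have := lt_searchGain_sub hF; linarith
  -- This solves (K - k₂) / k₂ = τ / 2. If K < μ, then at cost K the payoff c is at most μ, which
  -- falls short of μ - K + g(μ - K) by τ; lowering the cost to k₂ makes up at most half of this, so
  -- S cannot reach beyond k₂.
  set k₂ := K / (1 + τ / 2) with hk₂
  have hk₂pos : 0 < k₂ := by positivity
  have hk₂K : k₂ < K := by
    rw [hk₂, div_lt_iff₀ (by positivity)]; nlinarith
  have hk₂eq : (K - k₂) / k₂ = τ / 2 := by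
    rw [hk₂]; field_simp; ring
  -- For k < K = g(μ), c is at least μ, so the maximum in the monopoly condition is c.
  have hSmu : ∀ κ ∈ S, ∀ k, 0 < k → k ≤ κ → k < K → μ - k + g (μ - k) ≤ mcCallPayoff F k := by
    intro κ hκ k hk hkκ hkK
    have h1 := (hS κ hκ).2.2 k hk hkκ
    rwa [max_eq_right (le_mcCallPayoff hk (by linarith) hkK.le)] at h1
  have hSlt : ∀ κ ∈ S, κ ≤ k₂ := by
    intro κ hκ
    by_contra! hlt
    have h1 := hSmu κ hκ k₂ hk₂pos hlt.le hk₂K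
    rcases hKμ.lt_or_eq with hKμ' | hKμ'
    · have h2 := mcCallPayoff_le_add (F := F) hk₂pos hk₂K.le hKμ'
      have h3 : mcCallPayoff F K ≤ μ := mcCallPayoff_le hKpos hKμ' le_rfl
      have h4 := searchGain_le_add (F := F) (show μ - K ≤ μ - k₂ by linarith)
      simp only [← hg] at h4
      rw [hk₂eq] at h2
      linarith
    · -- then the prior mean equals the gain, which is impossible
      have h5 : g (μ - K) = K := by
        rw [← hKμ', sub_self]
        have h6 := searchGain_le_add (F := F) (show (0 : ℝ) ≤ μ from (priorMean_mem F).1)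
        refine le_antisymm ?_ (searchGain_antitone (priorMean_mem F).1)
        have h7 : g 0 = μ := by
          simp only [hg, hμ, searchGain, priorMean]
          exact integral_congr_ae (Filter.Eventually.of_forall fun θ => by
            simp only; rw [max_eq_left (by linarith [θ.2.1]), sub_zero])
        rw [h7, hKμ']
      linarith
  have hSbdd : BddAbove S := ⟨k₂, hSlt⟩
  have hSup : sSup S ≤ k₂ := Real.sSup_le hSlt hk₂pos.le
  -- the choice of the threshold
  set k₃ := max (sSup S) k₁ with hk₃
  have hk₃K : k₃ < K := max_lt (hSup.trans_lt hk₂K) hk₁K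
  have hk₃1 : k₁ ≤ k₃ := le_max_right _ _
  -- The first bound makes the loss η / k₁ at most half of k₁ ^ 2; the second keeps the new
  -- threshold below K.
  set η := min (k₁ ^ 3 / 2) ((K - k₃) / 2) with hη
  have hηpos : 0 < η := lt_min (by positivity) (by linarith)
  have hη1 : η ≤ k₁ ^ 3 / 2 := min_le_left _ _
  have hη2 : η ≤ (K - k₃) / 2 := min_le_right _ _
  have hmid : ∀ k, k₁ ≤ k → k ≤ k₃ + η / 2 →
      - (η / k₁) ≤ mcCallPayoff F k - (μ - k + g (μ - k)) := by
    intro k hk hkk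
    have hkK : k < K := by linarith
    by_cases hc : k < sSup S
    -- The real supremum of the empty set is 0, which no k ≥ k₁ can be below.
    · have hne : S.Nonempty := by
        by_contra hne
        rw [Set.not_nonempty_iff_eq_empty.1 hne, Real.sSup_empty] at hc
        linarith
      obtain ⟨κ, hκ, hlt⟩ := exists_lt_of_lt_csSup hne hc
      have := hSmu κ hκ k (by linarith) hlt.le hkK
      have : 0 ≤ η / k₁ := by positivity
      linarith
    · push Not at hc
      -- a slightly smaller cost at which the margin is nonnegative
      obtain ⟨l, hl1, hlk, hlη, hl⟩ : ∃ l, k₁ ≤ l ∧ l ≤ k ∧ k - l ≤ η ∧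
          0 ≤ mcCallPayoff F l - (μ - l + g (μ - l)) := by
        by_cases hs : sSup S - η / 2 ≤ k₁
        · refine ⟨k₁, le_rfl, hk, ?_, ?_⟩
          · have : k₃ ≤ k₁ + η / 2 := max_le (by linarith) (by linarith)
            linarith
          · have := hsmall k₁ hk₁pos le_rfl; linarith
        · push Not at hs
          have hk3 : k₃ = sSup S := max_eq_left (by linarith)
          have hne : S.Nonempty := by
            by_contra hne
            rw [Set.not_nonempty_iff_eq_empty.1 hne, Real.sSup_empty] at hs
            linarith
          obtain ⟨κ, hκ, hlt⟩ := exists_lt_of_lt_csSup hne (show sSup S - η / 2 < sSup S by linarith)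
          refine ⟨sSup S - η / 2, hs.le, by linarith, by linarith, ?_⟩
          have := hSmu κ hκ _ (by linarith) hlt.le (by linarith)
          linarith
      have h1 := hcont l k (by linarith) hlk hkK
      have h2 : (k - l) / l ≤ η / k₁ := by gcongr
      linarith
  refine ⟨k₃ + η / 2, by have := le_max_left (sSup S) k₁; linarith, by linarith,
    min (g (μ + K) / 2) (k₁ ^ 2 / 2), lt_min (by positivity) (by positivity), fun k hk hkk => ?_⟩
  rcases le_total k k₁ with h | h
  · have h1 := hsmall k hk h
    have h2 := min_le_left (g (μ + K) / 2) (k₁ ^ 2 / 2)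
    nlinarith [sq_nonneg k]
  · have h1 := hmid k h hkk
    have h2 := min_le_right (g (μ + K) / 2) (k₁ ^ 2 / 2)
    have h3 : η / k₁ ≤ k₁ ^ 2 / 2 := by
      rw [div_le_iff₀ hk₁pos]; nlinarith
    have h4 : k₁ ^ 2 ≤ k ^ 2 := by gcongr
    linarith

end Gain

/-! ### Signals -/

section Signals

variable {F : Measure unitInterval}

theorem measure_eq_of_Iic_rat {G H : Measure unitInterval} [IsProbabilityMeasure G]
    [IsProbabilityMeasure H]
    (h : ∀ q : ℚ, G ((↑) ⁻¹' Set.Iic (q : ℝ)) = H ((↑) ⁻¹' Set.Iic (q : ℝ))) : G = H := by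
  have hc : Measurable ((↑) : unitInterval → ℝ) := measurable_subtype_coe
  have hG := Measure.isProbabilityMeasure_map (μ := G) hc.aemeasurable
  have hH := Measure.isProbabilityMeasure_map (μ := H) hc.aemeasurable
  have hmap : G.map ((↑) : unitInterval → ℝ) = H.map (↑) := by
    refine ext_of_generate_finite _ (BorelSpace.measurable_eq.trans Real.borel_eq_generateFrom_Iic_rat)
      Real.isPiSystem_Iic_rat ?_ (by simp)
    intro s hs
    simp only [Set.mem_iUnion, Set.mem_singleton_iff] at hs
    obtain ⟨q, rfl⟩ := hs
    rw [Measure.map_apply hc measurableSet_Iic, Measure.map_apply hc measurableSet_Iic, h q]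
  have := congrArg (Measure.comap ((↑) : unitInterval → ℝ)) hmap
  rwa [unitInterval.measurableEmbedding_coe.comap_map,
    unitInterval.measurableEmbedding_coe.comap_map] at this

/-- A distribution on the interval is determined by its distribution function at rational points, so
a signal is singled out by countably many measurable conditions. This lets strategies detect
departures from a standing offer, and lets integrals against point masses be evaluated without
measurability of the integrand. -/
instance instMeasurableSingletonClassSignal : MeasurableSingletonClass (Signal F) where
  measurableSet_singleton G := by
    have hmeas : ∀ q : ℚ, Measurable fun H : Signal F =>
        (H : Measure unitInterval) ((↑) ⁻¹' Set.Iic (q : ℝ)) := fun q =>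
      (Measure.measurable_coe (measurable_subtype_coe measurableSet_Iic)).comp
        measurable_subtype_coe
    have hset : ({G} : Set (Signal F)) = ⋂ q : ℚ, {H : Signal F |
        (H : Measure unitInterval) ((↑) ⁻¹' Set.Iic (q : ℝ))
          = (G : Measure unitInterval) ((↑) ⁻¹' Set.Iic (q : ℝ))} := by
      ext H
      simp only [Set.mem_singleton_iff, Set.mem_iInter, Set.mem_ofPred_eq]
      refine ⟨fun h q => by rw [h], fun h => Subtype.ext ?_⟩
      have := H.2.1
      have := G.2.1
      exact measure_eq_of_Iic_rat h
    rw [hset]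
    exact MeasurableSet.iInter fun q => hmeas q (measurableSet_singleton _)

/-- The value of stopping at a posterior mean drawn from `G` with outside value `u`. -/
def optionValue (u : ℝ) (G : Measure unitInterval) : ℝ := ∫ m : unitInterval, max (m : ℝ) u ∂G

theorem convexOn_max (u : ℝ) : ConvexOn ℝ Set.univ fun x : ℝ => max x u :=
  (convexOn_id convex_univ).sup (convexOn_const u convex_univ)

theorem continuous_of_convexOn {φ : ℝ → ℝ} (hφ : ConvexOn ℝ Set.univ φ) : Continuous φ :=
  continuousOn_univ.1 (hφ.continuousOn isOpen_univ)

theorem integrable_of_convexOn {G : Measure unitInterval} [IsFiniteMeasure G] {φ : ℝ → ℝ}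
    (hφ : ConvexOn ℝ Set.univ φ) : Integrable (fun m : unitInterval => φ (m : ℝ)) G :=
  integrable_of_continuous ((continuous_of_convexOn hφ).comp continuous_subtype_val)

theorem optionValue_le (G : Signal F) (u : ℝ) :
    optionValue u (G : Measure unitInterval) ≤ optionValue u F :=
  G.2.2 _ (convexOn_max u)

variable [IsProbabilityMeasure F]

/-- The fully informative signal. -/
def fullSignal (F : Measure unitInterval) [IsProbabilityMeasure F] : Signal F :=
  ⟨F, inferInstance, fun _ _ => le_rfl⟩

theorem optionValue_full (u : ℝ) :
    optionValue u (fullSignal F : Measure unitInterval) = u + searchGain F u :=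
  integral_max_eq (F := F) u

theorem optionValue_prior (u : ℝ) :
    optionValue u (Measure.dirac ⟨priorMean F, priorMean_mem F⟩) = max (priorMean F) u := by
  rw [optionValue, integral_dirac]

/-- The uninformative signal. -/
def nullSignal (F : Measure unitInterval) [IsProbabilityMeasure F] : Signal F :=
  ⟨Measure.dirac ⟨priorMean F, priorMean_mem F⟩, inferInstance, fun φ hφ => by
    rw [integral_dirac]
    exact hφ.map_integral_le (continuous_of_convexOn hφ).continuousOn isClosed_univ
      (Filter.Eventually.of_forall fun _ => Set.mem_univ _) integrable_coe
      (integrable_of_convexOn hφ)⟩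

/-- The signal drawn from `G` with probability `1 - l` and from `H` with probability `l`. -/
def mixSignal (l : unitInterval) (G H : Signal F) : Signal F :=
  ⟨ENNReal.ofReal (1 - l) • (G : Measure unitInterval) +
      ENNReal.ofReal l • (H : Measure unitInterval), by
    have := G.2.1
    have := H.2.1
    have h0 := l.2.1
    have h1 := l.2.2
    refine ⟨⟨?_⟩, fun φ hφ => ?_⟩
    · simp only [Measure.add_apply, Measure.smul_apply, measure_univ, smul_eq_mul, mul_one]
      rw [← ENNReal.ofReal_add (by linarith) h0]; simp
    · rw [integral_add_measure ((integrable_of_convexOn hφ).smul_measure ENNReal.ofReal_ne_top)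
        ((integrable_of_convexOn hφ).smul_measure ENNReal.ofReal_ne_top),
        integral_smul_measure, integral_smul_measure, ENNReal.toReal_ofReal (by linarith),
        ENNReal.toReal_ofReal h0, smul_eq_mul, smul_eq_mul]
      have hG := G.2.2 φ hφ
      have hH := H.2.2 φ hφ
      nlinarith⟩

omit [IsProbabilityMeasure F] in
theorem optionValue_mix (l : unitInterval) (G H : Signal F) (u : ℝ) :
    optionValue u (mixSignal l G H : Measure unitInterval) =
      (1 - l) * optionValue u (G : Measure unitInterval) +
        l * optionValue u (H : Measure unitInterval) := by
  have := G.2.1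
  have := H.2.1
  have h0 := l.2.1
  have h1 := l.2.2
  simp only [optionValue, mixSignal]
  rw [integral_add_measure ((integrable_of_convexOn (convexOn_max u)).smul_measure
      ENNReal.ofReal_ne_top) ((integrable_of_convexOn (convexOn_max u)).smul_measure
      ENNReal.ofReal_ne_top),
    integral_smul_measure, integral_smul_measure, ENNReal.toReal_ofReal (by linarith),
    ENNReal.toReal_ofReal h0, smul_eq_mul, smul_eq_mul]

/-- With probability `k`, the signal reveals the qualities above `c`; otherwise it is silent. -/
theorem exists_rare_disclosure {k : ℝ} (hk : 0 < k) (hk1 : k < 1) (c : ℝ)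
    (hc : priorMean F - k ≤ c) :
    ∃ G : Signal F, optionValue (priorMean F - k) (G : Measure unitInterval) = priorMean F ∧
      c + k * searchGain F c ≤ optionValue c (G : Measure unitInterval) := by
  set A : Set unitInterval := {θ | c < (θ : ℝ)} with hA
  have hAm : MeasurableSet A := measurableSet_lt measurable_const measurable_subtype_coe
  set ρ := F.restrict A with hρ
  -- The part of F left undisclosed; the signal pools it at its mean l.
  set ν := ENNReal.ofReal (1 - k) • ρ + F.restrict Aᶜ with hν
  have hdec : ∀ φ : unitInterval → ℝ, Continuous φ →
      ∫ θ, φ θ ∂ν = ∫ θ, φ θ ∂F - k * ∫ θ, φ θ ∂ρ := by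
    intro φ hφ
    have h1 : ∫ θ, φ θ ∂F = ∫ θ, φ θ ∂ρ + ∫ θ, φ θ ∂(F.restrict Aᶜ) :=
      (integral_add_compl hAm (integrable_of_continuous hφ)).symm
    rw [hν, integral_add_measure ((integrable_of_continuous hφ).smul_measure ENNReal.ofReal_ne_top)
      (integrable_of_continuous hφ), integral_smul_measure, ENNReal.toReal_ofReal (by linarith),
      smul_eq_mul, h1]
    ring
  have hνfin : IsFiniteMeasure ν := by
    rw [hν]
    have : IsFiniteMeasure (ENNReal.ofReal (1 - k) • ρ) :=
      Measure.smul_finite ρ ENNReal.ofReal_ne_top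
    infer_instance
  set p := ρ.real Set.univ with hp
  have hp0 : 0 ≤ p := measureReal_nonneg
  have hp1 : p ≤ 1 := by
    rw [hp, hρ, measureReal_restrict_apply MeasurableSet.univ]; exact measureReal_le_one
  have hmass : ν.real Set.univ = 1 - k * p := by
    have := hdec (fun _ => 1) continuous_const
    simpa using this
  have hmasspos : 0 < 1 - k * p := by nlinarith
  have hνne : NeZero ν := ⟨fun h => by rw [h] at hmass; simp at hmass; linarith⟩
  have hI0 : ∀ θ : unitInterval, 0 ≤ (θ : ℝ) ∧ (θ : ℝ) ≤ 1 := fun θ => θ.2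
  set a := ∫ θ : unitInterval, (θ : ℝ) ∂ρ with ha
  have ha1 : a ≤ p := by
    have := integral_mono (μ := ρ) integrable_coe (integrable_const (1 : ℝ)) fun θ => (hI0 θ).2
    simpa [ha, hp] using this
  have hnum : ∫ θ : unitInterval, (θ : ℝ) ∂ν = priorMean F - k * a := hdec _ (by fun_prop)
  have hnum0 : 0 ≤ priorMean F - k * a := hnum ▸ integral_nonneg fun θ => (hI0 θ).1
  set l := (priorMean F - k * a) / (1 - k * p) with hl
  have hl_mul : (1 - k * p) * l = priorMean F - k * a := by rw [hl]; field_simp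
  have hμ1 := (priorMean_mem F).2
  have hnum1 : priorMean F - k * a ≤ 1 - k * p := by
    rw [← hnum, ← hmass]
    have := integral_mono (μ := ν) integrable_coe (integrable_const (1 : ℝ)) fun θ => (hI0 θ).2
    simpa using this
  have hlI : l ∈ unitInterval := ⟨div_nonneg hnum0 hmasspos.le, (div_le_one hmasspos).2 hnum1⟩
  -- Disclosure takes away at most k * a ≤ k of the mean, and dividing by a mass of at most one
  -- cannot lower the rest. So no realization is below μ - k, and that outside value is never used.
  have hlk : priorMean F - k ≤ l := by
    have h1 : l ≥ (1 - k * p) * l := by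
      have := mul_nonneg (mul_nonneg hk.le hp0) hlI.1; linarith
    nlinarith
  have havg : ∀ f : unitInterval → ℝ, ⨍ θ, f θ ∂ν = (∫ θ, f θ ∂ν) / (1 - k * p) := by
    intro f
    rw [average_eq, hmass, smul_eq_mul, inv_mul_eq_div]
  set G : Measure unitInterval := ENNReal.ofReal k • ρ + ENNReal.ofReal (1 - k * p) •
    Measure.dirac ⟨l, hlI⟩ with hG
  have hGint : ∀ φ : unitInterval → ℝ, Continuous φ →
      ∫ m, φ m ∂G = k * ∫ θ, φ θ ∂ρ + (1 - k * p) * φ ⟨l, hlI⟩ := by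
    intro φ hφ
    rw [hG, integral_add_measure ((integrable_of_continuous hφ).smul_measure ENNReal.ofReal_ne_top)
      ((integrable_of_continuous hφ).smul_measure ENNReal.ofReal_ne_top), integral_smul_measure,
      integral_smul_measure, ENNReal.toReal_ofReal hk.le, ENNReal.toReal_ofReal hmasspos.le,
      integral_dirac, smul_eq_mul, smul_eq_mul]
  have hGmpc : IsMeanPreservingContraction F G := by
    refine ⟨⟨?_⟩, fun φ hφ => ?_⟩
    · have h1 : ρ Set.univ = ENNReal.ofReal p := by
        rw [hp, Measure.real, ENNReal.ofReal_toReal (measure_ne_top _ _)]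
      simp only [hG, Measure.add_apply, Measure.smul_apply, measure_univ, smul_eq_mul, mul_one, h1]
      rw [← ENNReal.ofReal_mul hk.le, ← ENNReal.ofReal_add (by positivity) hmasspos.le]
      simp
    · have hcont : Continuous fun m : unitInterval => φ (m : ℝ) :=
        (continuous_of_convexOn hφ).comp continuous_subtype_val
      rw [hGint _ hcont]
      have hj := hφ.map_average_le (μ := ν) (f := fun θ : unitInterval => (θ : ℝ))
        (continuous_of_convexOn hφ).continuousOn isClosed_univ
        (Filter.Eventually.of_forall fun _ => Set.mem_univ _) integrable_coe
        (integrable_of_convexOn hφ)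
      rw [havg, hnum, havg, hdec _ hcont, le_div_iff₀ hmasspos] at hj
      simp only
      rw [← hl] at hj
      linarith
  refine ⟨⟨G, hGmpc⟩, ?_, ?_⟩
  · rw [optionValue, hGint _ (by fun_prop)]
    simp only
    rw [max_eq_left hlk, hl_mul]
    have : ∫ θ : unitInterval, max (θ : ℝ) (priorMean F - k) ∂ρ = a := by
      refine setIntegral_congr_fun hAm fun θ hθ => ?_
      have : c < (θ : ℝ) := hθ
      exact max_eq_left (by linarith)
    rw [this]; ring
  · rw [optionValue, hGint _ (by fun_prop)]
    simp only
    have h1 : ∫ θ : unitInterval, max (θ : ℝ) c ∂ρ = searchGain F c + c * p := by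
      have h2 : searchGain F c = ∫ θ : unitInterval, max ((θ : ℝ) - c) 0 ∂ρ := by
        rw [searchGain, ← integral_add_compl hAm (integrable_gain c)]
        have : ∫ θ in Aᶜ, max ((θ : ℝ) - c) 0 ∂F = 0 :=
          setIntegral_eq_zero_of_forall_eq_zero fun θ hθ => by
            have : (θ : ℝ) ≤ c := not_lt.1 hθ
            exact max_eq_right (by linarith)
        rw [this, add_zero]
      rw [h2]
      have h3 : ∀ θ : unitInterval, max (θ : ℝ) c = max ((θ : ℝ) - c) 0 + c := fun θ => by
        rcases le_total (θ : ℝ) c with h | h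
        · rw [max_eq_right h, max_eq_right (by linarith)]; ring
        · rw [max_eq_left h, max_eq_left (by linarith)]; ring
      simp_rw [h3]
      rw [integral_add (integrable_gain c) (integrable_const _)]
      simp [hp, mul_comm]
    rw [h1]
    have h4 := mul_le_mul_of_nonneg_left (le_max_right l c) hmasspos.le
    nlinarith

/-- The value of a fully revealed quality if the outside value is `v` below the threshold `a` and
`u` above it. -/
theorem exists_threshold_value (hF : F ≪ volume) {u v V : ℝ} (h1 : optionValue u F ≤ V)
    (h2 : V ≤ optionValue v F) :
    ∃ a : ℝ, ∫ θ : unitInterval, max (θ : ℝ) (if (θ : ℝ) < a then v else u) ∂F = V := by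
  set Φ : ℝ → ℝ := fun a => ∫ θ : unitInterval, max (θ : ℝ) (if (θ : ℝ) < a then v else u) ∂F
  have hcont : Continuous Φ := by
    rw [continuous_iff_continuousAt]
    intro a
    refine continuousAt_of_dominated (bound := fun _ => 1 + |u| + |v|) ?_ ?_ (integrable_const _) ?_
    · refine Filter.Eventually.of_forall fun b => Measurable.aestronglyMeasurable ?_
      exact measurable_subtype_coe.max (Measurable.ite
        (measurableSet_lt measurable_subtype_coe measurable_const) measurable_const
        measurable_const)
    · refine Filter.Eventually.of_forall fun b => Filter.Eventually.of_forall fun θ => ?_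
      have h0 := θ.2.1
      have h1 := θ.2.2
      have hu := abs_nonneg u
      have hv := abs_nonneg v
      have hu' := le_abs_self u
      have hv' := le_abs_self v
      rw [Real.norm_eq_abs, abs_of_nonneg (le_max_of_le_left h0)]
      refine max_le (by linarith) ?_
      split_ifs <;> linarith
    -- The integrand is discontinuous in the threshold only at θ = a, which has probability zero
    -- because F has no atoms.
    · have hne : ∀ᵐ θ ∂F, (θ : unitInterval).1 ≠ a := by
        by_cases ha : a ∈ unitInterval
        · have : F {(⟨a, ha⟩ : unitInterval)} = 0 := measure_singleton_of_absolutelyContinuous hF _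
          filter_upwards [compl_mem_ae_iff.2 this] with θ hθ h
          exact hθ (Subtype.ext h)
        · exact Filter.Eventually.of_forall fun θ h => ha (h ▸ θ.2)
      filter_upwards [hne] with θ hθ
      rcases lt_or_gt_of_ne hθ with h | h
      · refine (continuousAt_const (y := max (θ : ℝ) v)).congr ?_
        filter_upwards [lt_mem_nhds h] with b hb
        rw [if_pos hb]
      · refine (continuousAt_const (y := max (θ : ℝ) u)).congr ?_
        filter_upwards [gt_mem_nhds h] with b hb
        rw [if_neg (not_lt.2 hb.le)]
  have hΦ0 : Φ 0 = optionValue u F := integral_congr_ae (Filter.Eventually.of_forall fun θ => by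
    simp only; rw [if_neg (not_lt.2 θ.2.1)])
  have hΦ2 : Φ 2 = optionValue v F := integral_congr_ae (Filter.Eventually.of_forall fun θ => by
    simp only; rw [if_pos (by linarith [θ.2.2])])
  obtain ⟨a, -, ha⟩ := intermediate_value_Icc (show (0 : ℝ) ≤ 2 by norm_num) hcont.continuousOn
    (show V ∈ Set.Icc (Φ 0) (Φ 2) by rw [hΦ0, hΦ2]; exact ⟨h1, h2⟩)
  exact ⟨a, ha⟩

end Signals

/-! ### Verification of payoffs -/

section Verification

variable {F : Measure unitInterval} [IsProbabilityMeasure F] {n : ℕ}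

instance instIsProbabilityMeasureSignal (O : Fin n → Offer F) (w : Choice n) :
    IsProbabilityMeasure (signal O w) := by
  cases w with
  | none => exact Measure.dirac.isProbabilityMeasure
  | some i => exact (O i).2.2.1

instance instIsProbabilityMeasureOfferLaw (σ : Profile F n) (t : ℕ) (h : History F n t) :
    IsProbabilityMeasure (offerLaw σ t h) := by
  have : ∀ i, IsMarkovKernel ((σ.broker i).offer t) := fun i => (σ.broker i).markov t
  unfold offerLaw
  infer_instance

variable {σ : Profile F n} {t : ℕ} {h : History F n t} {O : Fin n → Offer F} {k : ℝ}

omit [IsProbabilityMeasure F] in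
theorem sum_buy : ∑ w, σ.agent.buy t h O w = 1 := by
  rw [← tsum_fintype (L := .unconditional _)]; exact (σ.agent.buy t h O).tsum_coe

omit [IsProbabilityMeasure F] in
theorem sum_buy_mul_add (a : Choice n → ℝ≥0∞) (c : ℝ≥0∞) :
    ∑ w, σ.agent.buy t h O w * (a w + c) = ∑ w, σ.agent.buy t h O w * a w + c := by
  simp_rw [mul_add]
  rw [Finset.sum_add_distrib, ← Finset.sum_mul, sum_buy, one_mul]

theorem expectStage_mono {f g : Stage F n → ℝ≥0∞} (hfg : ∀ s, f s ≤ g s) :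
    expectStage σ t h O f ≤ expectStage σ t h O g :=
  Finset.sum_le_sum fun _ _ => mul_le_mul_right (lintegral_mono fun _ => hfg _) _

theorem expectStage_const_add (c : ℝ≥0∞) (f : Stage F n → ℝ≥0∞) :
    expectStage σ t h O (fun s => c + f s) = expectStage σ t h O f + c := by
  unfold expectStage
  rw [← sum_buy_mul_add]
  refine Finset.sum_congr rfl fun w _ => ?_
  rw [lintegral_add_left measurable_const, lintegral_const, measure_univ, mul_one, add_comm]

theorem expectStage_le_one {f : Stage F n → ℝ≥0∞} (hf : ∀ s, f s ≤ 1) :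
    expectStage σ t h O f ≤ 1 :=
  calc expectStage σ t h O f ≤ expectStage σ t h O (fun _ => 1 + 0) :=
        expectStage_mono fun s => by rw [add_zero]; exact hf s
    _ = 1 := by rw [expectStage_const_add]; simp [expectStage]

theorem expectStage_const_mul {c : ℝ≥0∞} (hc : c ≠ ∞) (f : Stage F n → ℝ≥0∞) :
    expectStage σ t h O (fun s => c * f s) = c * expectStage σ t h O f := by
  unfold expectStage
  rw [Finset.mul_sum]
  refine Finset.sum_congr rfl fun w _ => ?_
  rw [lintegral_const_mul' _ _ hc]; ring

omit [IsProbabilityMeasure F] in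
theorem stopProb_add_contProb (s : Stage F n) : stopProb σ t h s + contProb σ t h s = 1 := by
  have h0 := (σ.agent.cont t h s).2.1
  have h1 := (σ.agent.cont t h s).2.2
  unfold stopProb contProb
  rw [← ENNReal.ofReal_add (by linarith) h0]; simp

omit [IsProbabilityMeasure F] in
-- Stopping and continuing have total probability one, and a weighted average is at most the larger
-- term.
theorem consumption_add_le (s : Stage F n) (x : ℝ≥0∞) :
    consumption σ t h s + contProb σ t h s * x ≤ max (ENNReal.ofReal (s.2.2 : ℝ)) x := by
  calc consumption σ t h s + contProb σ t h s * x
      ≤ stopProb σ t h s * max (ENNReal.ofReal (s.2.2 : ℝ)) x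
        + contProb σ t h s * max (ENNReal.ofReal (s.2.2 : ℝ)) x := by
        unfold consumption
        gcongr
        · exact le_max_left _ _
        · exact le_max_right _ _
    _ = _ := by rw [← add_mul, stopProb_add_contProb, one_mul]

theorem ofReal_unitInterval_le_one (m : unitInterval) : ENNReal.ofReal (m : ℝ) ≤ 1 :=
  ENNReal.ofReal_le_one.2 m.2.2

omit [IsProbabilityMeasure F] in
theorem measurable_consumption (w : Choice n) :
    Measurable fun m : unitInterval => consumption σ t h (O, w, m) := by
  have h1 : Measurable fun m : unitInterval => σ.agent.cont t h (O, w, m) :=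
    (σ.agent.measurable_cont t).comp
      (measurable_const.prodMk (measurable_const.prodMk (measurable_const.prodMk measurable_id)))
  unfold consumption stopProb
  exact ((measurable_const.sub (measurable_subtype_coe.comp h1)).ennreal_ofReal).mul
    measurable_subtype_coe.ennreal_ofReal

omit [IsProbabilityMeasure F] in
theorem measurable_contProb (w : Choice n) :
    Measurable fun m : unitInterval => contProb σ t h (O, w, m) := by
  have h1 : Measurable fun m : unitInterval => σ.agent.cont t h (O, w, m) :=
    (σ.agent.measurable_cont t).comp
      (measurable_const.prodMk (measurable_const.prodMk (measurable_const.prodMk measurable_id)))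
  exact (measurable_subtype_coe.comp h1).ennreal_ofReal

theorem expectStage_expense (x : Stage F n → ℝ≥0∞) :
    expectStage σ t h O (fun s => expense k s + contProb σ t h s * x s) =
      ∑ w, σ.agent.buy t h O w * ((price O w : ℝ≥0∞) +
        ∫⁻ m, contProb σ t h (O, w, m) * x (O, w, m) ∂(signal O w)) + ENNReal.ofReal k := by
  rw [← sum_buy_mul_add]
  unfold expectStage
  refine Finset.sum_congr rfl fun w _ => ?_
  simp only [expense]
  rw [lintegral_add_left measurable_const, lintegral_const, measure_univ, mul_one]
  ring

/-- One step of the upper bound on the agent's payoff. -/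
theorem expectStage_consumption_le {V : ℝ≥0∞} {W c x : Stage F n → ℝ≥0∞}
    (hW : ∀ w, Measurable fun m => W (O, w, m))
    (hV : ∀ w, σ.agent.buy t h O w ≠ 0 →
      ∫⁻ m, max (ENNReal.ofReal (m : ℝ)) (W (O, w, m)) ∂(signal O w) ≤ V + price O w)
    (hc : ∀ s, c s ≤ W s + x s) :
    expectStage σ t h O (fun s => consumption σ t h s + contProb σ t h s * c s)
        + ENNReal.ofReal k ≤
      V + expectStage σ t h O (fun s => expense k s + contProb σ t h s * x s) := by
  rw [expectStage_expense, ← add_assoc, add_comm V, ← sum_buy_mul_add]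
  gcongr
  unfold expectStage
  refine Finset.sum_le_sum fun w _ => ?_
  -- Decisions of probability zero impose no constraint; this is what bounds the value of an agent
  -- who surely refuses an offer.
  by_cases hw : σ.agent.buy t h O w = 0
  · simp [hw]
  refine mul_le_mul_right ?_ _
  calc ∫⁻ m, (consumption σ t h (O, w, m) + contProb σ t h (O, w, m) * c (O, w, m)) ∂(signal O w)
      ≤ ∫⁻ m, ((consumption σ t h (O, w, m) + contProb σ t h (O, w, m) * W (O, w, m))
          + contProb σ t h (O, w, m) * x (O, w, m)) ∂(signal O w) := by
        refine lintegral_mono fun m => ?_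
        simp only
        rw [add_assoc, ← mul_add]
        gcongr
        exact hc _
    -- Additivity needs only one measurable summand, so nothing is required of the future expenses
    -- `x`.
    _ = ∫⁻ m, (consumption σ t h (O, w, m) + contProb σ t h (O, w, m) * W (O, w, m)) ∂(signal O w)
          + ∫⁻ m, contProb σ t h (O, w, m) * x (O, w, m) ∂(signal O w) :=
        lintegral_add_left ((measurable_consumption w).add
          ((measurable_contProb w).mul (hW w))) _
    _ ≤ (V + price O w) + ∫⁻ m, contProb σ t h (O, w, m) * x (O, w, m) ∂(signal O w) := by
        gcongr
        exact (lintegral_mono fun m => consumption_add_le (O, w, m) _).trans (hV w hw)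
    _ = _ := by ring

/-- One step of the lower bound on the agent's payoff. -/
theorem le_expectStage_consumption {V : ℝ≥0∞} {W c x r : Stage F n → ℝ≥0∞}
    (hW : ∀ w, Measurable fun m => W (O, w, m)) (hr : ∀ w, Measurable fun m => r (O, w, m))
    (hV : ∀ w, σ.agent.buy t h O w ≠ 0 → V + price O w ≤
      ∫⁻ m, (consumption σ t h (O, w, m) + contProb σ t h (O, w, m) * W (O, w, m)) ∂(signal O w))
    (hc : ∀ s, W s + x s ≤ c s + r s) :
    V + expectStage σ t h O (fun s => expense k s + contProb σ t h s * x s) ≤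
      expectStage σ t h O (fun s => consumption σ t h s + contProb σ t h s * c s)
        + expectStage σ t h O (fun s => contProb σ t h s * r s) + ENNReal.ofReal k := by
  rw [expectStage_expense, ← add_assoc, add_comm V, ← sum_buy_mul_add]
  gcongr
  unfold expectStage
  rw [← Finset.sum_add_distrib]
  refine Finset.sum_le_sum fun w _ => ?_
  rw [← mul_add]
  by_cases hw : σ.agent.buy t h O w = 0
  · simp [hw]
  refine mul_le_mul_right ?_ _
  calc (price O w : ℝ≥0∞) + ∫⁻ m, contProb σ t h (O, w, m) * x (O, w, m) ∂(signal O w) + V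
      = (V + price O w) + ∫⁻ m, contProb σ t h (O, w, m) * x (O, w, m) ∂(signal O w) := by ring
    _ ≤ ∫⁻ m, (consumption σ t h (O, w, m) + contProb σ t h (O, w, m) * W (O, w, m)) ∂(signal O w)
          + ∫⁻ m, contProb σ t h (O, w, m) * x (O, w, m) ∂(signal O w) := by
        gcongr; exact hV w hw
    _ = ∫⁻ m, ((consumption σ t h (O, w, m) + contProb σ t h (O, w, m) * W (O, w, m))
          + contProb σ t h (O, w, m) * x (O, w, m)) ∂(signal O w) :=
        (lintegral_add_left ((measurable_consumption w).add
          ((measurable_contProb w).mul (hW w))) _).symm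
    _ ≤ ∫⁻ m, ((consumption σ t h (O, w, m) + contProb σ t h (O, w, m) * c (O, w, m))
          + contProb σ t h (O, w, m) * r (O, w, m)) ∂(signal O w) := by
        refine lintegral_mono fun m => ?_
        simp only
        rw [add_assoc, ← mul_add, add_assoc, ← mul_add]
        exact add_le_add le_rfl (mul_le_mul_right (hc _) _)
    _ = _ := lintegral_add_right _ ((measurable_contProb w).mul (hr w))

/-! #### Many periods -/

theorem expectedSum_succ_le_of_ae {c : ∀ t, History F n t → Stage F n → ℝ≥0∞} {N : ℕ} {b : ℝ≥0∞}
    (hb : ∀ᵐ O ∂(offerLaw σ t h), expectStage σ t h O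
      (fun s => c t h s + contProb σ t h s * expectedSum σ c N (t + 1) (extend h s)) ≤ b) :
    expectedSum σ c (N + 1) t h ≤ b := by
  rw [expectedSum]
  calc _ ≤ ∫⁻ _, b ∂(offerLaw σ t h) := lintegral_mono_ae hb
    _ = b := by simp

theorem expectedSum_mono (c : ∀ t, History F n t → Stage F n → ℝ≥0∞) :
    ∀ (N t : ℕ) (h : History F n t), expectedSum σ c N t h ≤ expectedSum σ c (N + 1) t h
  | 0, _, _ => zero_le
  | N + 1, t, h => by
    rw [expectedSum, expectedSum]
    refine lintegral_mono fun O => expectStage_mono fun s => ?_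
    gcongr
    exact expectedSum_mono c N _ _

theorem expectedSum_le_expectedTotal (c : ∀ t, History F n t → Stage F n → ℝ≥0∞) (N t : ℕ)
    (h : History F n t) : expectedSum σ c N t h ≤ expectedTotal σ c t h :=
  le_iSup (fun N => expectedSum σ c N t h) N

theorem expectedSum_consumption_le_one :
    ∀ (N t : ℕ) (h : History F n t), expectedSum σ (consumption σ) N t h ≤ 1
  | 0, _, _ => zero_le
  | N + 1, t, h => by
    exact expectedSum_succ_le_of_ae (Filter.Eventually.of_forall fun O => expectStage_le_one fun s =>
      (consumption_add_le s _).trans (max_le (ofReal_unitInterval_le_one s.2.2)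
        (expectedSum_consumption_le_one N _ _)))

theorem totalAfterOffers_consumption_le_one (t : ℕ) (h : History F n t) (O : Fin n → Offer F) :
    totalAfterOffers σ (consumption σ) t h O ≤ 1 :=
  expectStage_le_one fun s => (consumption_add_le s _).trans
    (max_le (ofReal_unitInterval_le_one _) (iSup_le fun N => expectedSum_consumption_le_one N _ _))

/-- The upper bound on the agent's payoff, for the first `N` periods. -/
theorem expectedSum_consumption_le {W : ∀ t, History F n t → ℝ≥0∞}
    (hW : ∀ t (h : History F n t) O w, Measurable fun m => W (t + 1) (extend h (O, w, m)))
    (hV : ∀ t (h : History F n t), ∀ᵐ O ∂(offerLaw σ t h), ∀ w,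
      ∫⁻ m, max (ENNReal.ofReal (m : ℝ)) (W (t + 1) (extend h (O, w, m))) ∂(signal O w) ≤
        W t h + ENNReal.ofReal k + price O w) :
    ∀ (N t : ℕ) (h : History F n t), expectedSum σ (consumption σ) N t h ≤
      W t h + expectedSum σ (fun _ _ => expense k) N t h
  | 0, _, _ => zero_le
  | N + 1, t, h => by
    rw [expectedSum, expectedSum]
    calc _ ≤ ∫⁻ O, (W t h + expectStage σ t h O (fun s => expense k s + contProb σ t h s *
              expectedSum σ (fun _ _ => expense k) N (t + 1) (extend h s))) ∂(offerLaw σ t h) := by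
            refine lintegral_mono_ae ?_
            filter_upwards [hV t h] with O hO
            have := expectStage_consumption_le (σ := σ) (k := k) (h := h)
              (W := fun s => W (t + 1) (extend h s)) (hW t h O) (fun w _ => hO w)
              (fun s => expectedSum_consumption_le hW hV N (t + 1) (extend h s))
            rw [add_right_comm] at this
            exact (ENNReal.add_le_add_iff_right ENNReal.ofReal_ne_top).1 this
      _ = _ := by
        rw [lintegral_add_left measurable_const, lintegral_const, measure_univ, mul_one]

theorem expectedTotal_consumption_le {W : ∀ t, History F n t → ℝ≥0∞}
    (hW : ∀ t (h : History F n t) O w, Measurable fun m => W (t + 1) (extend h (O, w, m)))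
    (hV : ∀ t (h : History F n t), ∀ᵐ O ∂(offerLaw σ t h), ∀ w,
      ∫⁻ m, max (ENNReal.ofReal (m : ℝ)) (W (t + 1) (extend h (O, w, m))) ∂(signal O w) ≤
        W t h + ENNReal.ofReal k + price O w) (t : ℕ) (h : History F n t) :
    expectedTotal σ (consumption σ) t h ≤
      W t h + expectedTotal σ (fun _ _ => expense k) t h :=
  iSup_le fun N => (expectedSum_consumption_le hW hV N t h).trans
    (add_le_add le_rfl (expectedSum_le_expectedTotal _ N t h))

/-- The probability that the agent is still searching after `N` periods. -/
def survival (σ : Profile F n) : ℕ → ∀ t, History F n t → ℝ≥0∞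
  | 0, _, _ => 1
  | N + 1, t, h => ∫⁻ O, expectStage σ t h O
      (fun s => contProb σ t h s * survival σ N (t + 1) (extend h s)) ∂(offerLaw σ t h)

theorem survival_le_one : ∀ (N t : ℕ) (h : History F n t), survival σ N t h ≤ 1
  | 0, _, _ => le_rfl
  | N + 1, t, h => by
    rw [survival]
    calc _ ≤ ∫⁻ _, 1 ∂(offerLaw σ t h) := by
            refine lintegral_mono fun O => expectStage_le_one fun s => ?_
            refine mul_le_one' ?_ (survival_le_one N _ _)
            rw [← stopProb_add_contProb (σ := σ) (t := t) (h := h) s]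
            exact le_add_self
      _ = 1 := by simp

/-- An agent still searching after N periods has paid the search cost N times. The induction splits
off the current cost, bounding survival by one there. -/
theorem mul_survival_le : ∀ (N t : ℕ) (h : History F n t),
    ENNReal.ofReal k * N * survival σ N t h ≤ expectedSum σ (fun _ _ => expense k) N t h
  | 0, _, _ => by simp
  | N + 1, t, h => by
    have hfin : ENNReal.ofReal k * N ≠ ∞ :=
      ENNReal.mul_ne_top ENNReal.ofReal_ne_top (ENNReal.natCast_ne_top N)
    calc ENNReal.ofReal k * (N + 1 : ℕ) * survival σ (N + 1) t h
        = ENNReal.ofReal k * N * survival σ (N + 1) t h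
          + ENNReal.ofReal k * survival σ (N + 1) t h := by push_cast; ring
      _ ≤ ENNReal.ofReal k * N * survival σ (N + 1) t h + ENNReal.ofReal k := by
          gcongr
          exact mul_le_of_le_one_right' (survival_le_one _ _ _)
      _ = ∫⁻ O, expectStage σ t h O (fun s => ENNReal.ofReal k + ENNReal.ofReal k * N *
            (contProb σ t h s * survival σ N (t + 1) (extend h s))) ∂(offerLaw σ t h) := by
          simp_rw [expectStage_const_add, expectStage_const_mul hfin]
          rw [lintegral_add_right _ measurable_const, lintegral_const_mul' _ _ hfin, survival]
          simp
      _ ≤ expectedSum σ (fun _ _ => expense k) (N + 1) t h := by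
          rw [expectedSum]
          refine lintegral_mono fun O => expectStage_mono fun s => ?_
          have := mul_survival_le N (t + 1) (extend h s)
          calc _ = ENNReal.ofReal k + contProb σ t h s *
                (ENNReal.ofReal k * N * survival σ N (t + 1) (extend h s)) := by ring
            _ ≤ _ := add_le_add le_self_add (mul_le_mul_right this _)

/-! ### Lower bound under deterministic offers -/

section Lower

variable {W : ∀ t, History F n t → ℝ≥0∞} {Ostar : ∀ t, History F n t → Fin n → Offer F}

/-- Cutting the play off after N periods forfeits the promised value W, at most one, only in the
event that search is still going on; the error is therefore at most `survival`. -/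
theorem le_expectedSum_consumption
    (hdet : ∀ t h, offerLaw σ t h = Measure.dirac (Ostar t h))
    (hW1 : ∀ t h, W t h ≤ 1)
    (hW : ∀ t (h : History F n t) O w, Measurable fun m => W (t + 1) (extend h (O, w, m)))
    (hS : ∀ N t (h : History F n t) O w,
      Measurable fun m => survival σ N (t + 1) (extend h (O, w, m)))
    (hV : ∀ t (h : History F n t) w, σ.agent.buy t h (Ostar t h) w ≠ 0 →
      W t h + ENNReal.ofReal k + price (Ostar t h) w ≤
      ∫⁻ m, (consumption σ t h (Ostar t h, w, m) + contProb σ t h (Ostar t h, w, m) *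
        W (t + 1) (extend h (Ostar t h, w, m))) ∂(signal (Ostar t h) w)) :
    ∀ (N t : ℕ) (h : History F n t),
      W t h + expectedSum σ (fun _ _ => expense k) N t h ≤
        expectedSum σ (consumption σ) N t h + survival σ N t h
  | 0, t, h => by simpa [expectedSum, survival] using hW1 t h
  | N + 1, t, h => by
    rw [expectedSum, expectedSum, survival, hdet, lintegral_dirac, lintegral_dirac,
      lintegral_dirac]
    have := le_expectStage_consumption (σ := σ) (k := k) (h := h) (O := Ostar t h)
      (W := fun s => W (t + 1) (extend h s)) (hW t h _) (hS N t h _) (hV t h)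
      (fun s => le_expectedSum_consumption hdet hW1 hW hS hV N (t + 1) (extend h s))
    rw [add_right_comm] at this
    exact (ENNReal.add_le_add_iff_right ENNReal.ofReal_ne_top).1 this

/-- The lower bound on the agent's payoff; positive search costs make search end. -/
theorem le_expectedTotal_consumption (hk : 0 < k)
    (hdet : ∀ t h, offerLaw σ t h = Measure.dirac (Ostar t h))
    (hW1 : ∀ t h, W t h ≤ 1)
    (hW : ∀ t (h : History F n t) O w, Measurable fun m => W (t + 1) (extend h (O, w, m)))
    (hS : ∀ N t (h : History F n t) O w,
      Measurable fun m => survival σ N (t + 1) (extend h (O, w, m)))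
    (hV : ∀ t (h : History F n t) w, σ.agent.buy t h (Ostar t h) w ≠ 0 →
      W t h + ENNReal.ofReal k + price (Ostar t h) w ≤
      ∫⁻ m, (consumption σ t h (Ostar t h, w, m) + contProb σ t h (Ostar t h, w, m) *
        W (t + 1) (extend h (Ostar t h, w, m))) ∂(signal (Ostar t h) w))
    (t : ℕ) (h : History F n t) :
    W t h + expectedTotal σ (fun _ _ => expense k) t h ≤ expectedTotal σ (consumption σ) t h ∧
      expectedTotal σ (fun _ _ => expense k) t h ≠ ∞ := by
  have key := le_expectedSum_consumption hdet hW1 hW hS hV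
  have hX : ∀ N, expectedSum σ (fun _ _ => expense k) N t h ≤ 2 := fun N =>
    calc _ ≤ W t h + expectedSum σ (fun _ _ => expense k) N t h := le_add_self
      _ ≤ _ := key N t h
      _ ≤ 1 + 1 := add_le_add (expectedSum_consumption_le_one N t h) (survival_le_one N t h)
      _ = 2 := one_add_one_eq_two
  refine ⟨?_, ne_top_of_le_ne_top ENNReal.ofNat_ne_top (iSup_le hX)⟩
  rw [expectedTotal, ENNReal.add_iSup]
  refine iSup_le fun N => ENNReal.le_of_forall_pos_le_add fun ε hε _ => ?_
  -- Expected expenses never exceed 2, while they are at least k * M times the survival probability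
  -- at horizon M.
  obtain ⟨M, hM⟩ := exists_nat_gt (2 / (k * ε))
  have hM' : 2 < k * (M : ℝ) * ε := by
    have hε' : (0 : ℝ) < ε := hε
    rw [div_lt_iff₀ (mul_pos hk hε')] at hM
    linarith
  have hMε : survival σ (max M N) t h ≤ ε := by
    by_contra! hlt
    have h1 : ENNReal.ofReal (k * (M : ℝ) * ε) ≤ 2 := by
      calc ENNReal.ofReal (k * (M : ℝ) * ε) = ENNReal.ofReal k * (M : ℝ≥0∞) * ε := by
            rw [ENNReal.ofReal_mul (by positivity), ENNReal.ofReal_mul hk.le,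
              ENNReal.ofReal_natCast, ENNReal.ofReal_coe_nnreal]
        _ ≤ ENNReal.ofReal k * ((max M N : ℕ) : ℝ≥0∞) * survival σ (max M N) t h := by
            gcongr
            exact le_max_left _ _
        _ ≤ _ := mul_survival_le _ t h
        _ ≤ 2 := hX _
    rw [ENNReal.ofReal_le_ofNat] at h1
    have : (2 : ℝ) < 2 := by exact_mod_cast hM'.trans_le h1
    exact lt_irrefl _ this
  calc W t h + expectedSum σ (fun _ _ => expense k) N t h
      ≤ W t h + expectedSum σ (fun _ _ => expense k) (max M N) t h := by
        gcongr
        exact monotone_nat_of_le_succ (fun N => expectedSum_mono _ N t h) (le_max_right M N)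
    _ ≤ _ := key _ t h
    _ ≤ _ := add_le_add (expectedSum_le_expectedTotal _ _ t h) hMε

end Lower

/-! #### Differences of expectations -/

/-- The verification inequalities are additive in `ℝ≥0∞`; this and the next lemma turn them into
bounds on extended real payoffs, with `e` a finite sunk amount. Infinite expenses give payoff -∞, so
the upper bound survives them. -/
theorem coe_sub_coe_le {a b e : ℝ≥0∞} {M : ℝ} (hM : 0 ≤ M) (he : e ≠ ∞)
    (hab : a + e ≤ ENNReal.ofReal M + b) : (a : EReal) - b ≤ ((M - e.toReal : ℝ) : EReal) := by
  rcases eq_or_ne b ∞ with rfl | hb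
  · simp
  have ha : a ≠ ∞ := fun h => by
    rw [h, top_add, top_le_iff] at hab
    exact (ENNReal.add_ne_top.2 ⟨ENNReal.ofReal_ne_top, hb⟩) hab
  lift a to ℝ≥0 using ha
  lift b to ℝ≥0 using hb
  lift e to ℝ≥0 using he
  rw [ENNReal.ofReal] at hab
  have h2 : (a : ℝ) + e ≤ M.toNNReal + b := by exact_mod_cast hab
  rw [Real.coe_toNNReal _ hM] at h2
  have : (((a : ℝ≥0∞) : EReal) - ((b : ℝ≥0∞) : EReal)) = (((a : ℝ) - (b : ℝ) : ℝ) : EReal) := by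
    rw [EReal.coe_sub]; rfl
  rw [this, EReal.coe_le_coe_iff]
  simp only [ENNReal.coe_toReal]
  linarith

theorem le_coe_sub_coe {a b e : ℝ≥0∞} {M : ℝ} (hM : 0 ≤ M) (he : e ≠ ∞) (hb : b ≠ ∞)
    (hab : ENNReal.ofReal M + b ≤ a + e) : ((M - e.toReal : ℝ) : EReal) ≤ (a : EReal) - b := by
  lift b to ℝ≥0 using hb
  lift e to ℝ≥0 using he
  rcases eq_or_ne a ∞ with rfl | ha
  · simp
  lift a to ℝ≥0 using ha
  rw [ENNReal.ofReal] at hab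
  have h2 : (M.toNNReal : ℝ) + b ≤ a + e := by exact_mod_cast hab
  rw [Real.coe_toNNReal _ hM] at h2
  have : (((a : ℝ≥0∞) : EReal) - ((b : ℝ≥0∞) : EReal)) = (((a : ℝ) - (b : ℝ) : ℝ) : EReal) := by
    rw [EReal.coe_sub]; rfl
  rw [this, EReal.coe_le_coe_iff]
  simp only [ENNReal.coe_toReal]
  linarith

end Verification

/-! ### Equilibria with three phases

In every phase, all brokers make the same standing offer. In the `reward` phase, the agent gets
free full information; in the `punish` phase, he does as well as without information. -/

/-- The phases of play. -/
inductive Phase : Type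
  | target
  | reward
  | punish

instance instFinitePhase : Finite Phase :=
  Finite.of_injective (β := Fin 3)
    (fun z => match z with | .target => 0 | .reward => 1 | .punish => 2) fun x y => by
      cases x <;> cases y <;> simp

instance instMeasurableSpacePhase : MeasurableSpace Phase := ⊤

instance instDiscreteMeasurableSpacePhase : DiscreteMeasurableSpace Phase :=
  ⟨fun _ => trivial⟩

instance instDiscreteMeasurableSpaceChoice (n : ℕ) : DiscreteMeasurableSpace (Choice n) :=
  ⟨fun _ => trivial⟩

/-- The data of an equilibrium with three phases: the standing offers, the posterior means below
which a purchase leads to the reward phase, the lottery by which the agent selects a broker, and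
the agent's payoffs. -/
structure Scheme (F : Measure unitInterval) (n : ℕ) where
  fee : Phase → ℝ≥0
  sig : Phase → Signal F
  threshold : Phase → ℝ
  lottery : PMF (Fin n)
  value : Phase → ℝ

/-! ### Option values as lower Lebesgue integrals -/

section OptionValue

theorem optionValue_eq_toReal (u : ℝ) (G : Measure unitInterval) :
    optionValue u G = (∫⁻ m : unitInterval, ENNReal.ofReal (max (m : ℝ) u) ∂G).toReal :=
  integral_eq_lintegral_of_nonneg_ae
    (Filter.Eventually.of_forall fun m => le_max_of_le_left m.2.1)
    (measurable_subtype_coe.max measurable_const).aestronglyMeasurable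

/-- As a lower Lebesgue integral of a fixed function, the value is measurable in the measure. The
agent's best choice among arbitrary offers depends on it. -/
theorem measurable_optionValue (u : ℝ) : Measurable (optionValue u) := by
  have : optionValue u = fun G =>
      (∫⁻ m : unitInterval, ENNReal.ofReal (max (m : ℝ) u) ∂G).toReal :=
    funext fun G => optionValue_eq_toReal u G
  rw [this]
  exact (Measure.measurable_lintegral
    (measurable_subtype_coe.max measurable_const).ennreal_ofReal).ennreal_toReal

/-- Truncating v at zero is harmless, because posterior means are nonnegative. -/
theorem lintegral_max_ofReal {G : Measure unitInterval} [IsProbabilityMeasure G]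
    {v : unitInterval → ℝ} (hv : Measurable v) (hv1 : ∀ m, v m ≤ 1) :
    ∫⁻ m : unitInterval, max (ENNReal.ofReal (m : ℝ)) (ENNReal.ofReal (v m)) ∂G =
      ENNReal.ofReal (∫ m : unitInterval, max (m : ℝ) (v m) ∂G) := by
  have hmeas : Measurable fun m : unitInterval => max (m : ℝ) (v m) :=
    measurable_subtype_coe.max hv
  rw [ofReal_integral_eq_lintegral_ofReal
    (Integrable.of_bound hmeas.aestronglyMeasurable 1 (Filter.Eventually.of_forall fun m => by
      rw [Real.norm_eq_abs, abs_of_nonneg (le_max_of_le_left m.2.1)]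
      exact max_le m.2.2 (hv1 m)))
    (Filter.Eventually.of_forall fun m => le_max_of_le_left m.2.1)]
  simp_rw [ENNReal.ofReal_max]

end OptionValue

/-! ### The strategy profile of a scheme and its measurability -/

namespace Scheme

variable {F : Measure unitInterval} {n : ℕ} (S : Scheme F n)

/-- The standing offer of every broker. -/
def standing (z : Phase) : Offer F := (S.fee z, S.sig z)

open Classical in
/-- The transition between phases. -/
def next (z : Phase) (s : Stage F n) : Phase :=
  match s.2.1 with
  | none => .punish
  | some j =>
    if s.1 j = S.standing z then
      if ∀ i, s.1 i = S.standing z then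
        if (s.2.2 : ℝ) < S.threshold z then .reward else .punish
      else .reward
    else .punish

/-- The phase after a history. -/
def phaseAt : ∀ t, History F n t → Phase
  | 0, _ => .target
  | t + 1, h => S.next (phaseAt t (Fin.init (α := fun _ => Stage F n) h)) (h (Fin.last t))

theorem phaseAt_extend {t : ℕ} (h : History F n t) (s : Stage F n) :
    S.phaseAt (t + 1) (extend h s) = S.next (S.phaseAt t h) s := by
  simp [phaseAt, extend]

theorem measurableSet_conform (z : Phase) :
    MeasurableSet {O : Fin n → Offer F | ∀ i, O i = S.standing z} := by
  have : {O : Fin n → Offer F | ∀ i, O i = S.standing z} =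
      ⋂ i, (fun O : Fin n → Offer F => O i) ⁻¹' {S.standing z} := by ext; simp
  rw [this]
  exact MeasurableSet.iInter fun i => measurable_pi_apply i (measurableSet_singleton _)

theorem measurableSet_conform_apply (z : Phase) (j : Fin n) :
    MeasurableSet {O : Fin n → Offer F | O j = S.standing z} :=
  have hj : Measurable fun O : Fin n → Offer F => O j := measurable_pi_apply j
  hj (measurableSet_singleton (S.standing z))

theorem measurable_next : Measurable fun x : Phase × Stage F n => S.next x.1 x.2 := by
  refine measurable_from_prod_countable_right fun z => ?_
  have : Measurable fun y : Choice n × ((Fin n → Offer F) × unitInterval) =>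
      S.next z (y.2.1, y.1, y.2.2) := by
    refine measurable_from_prod_countable_right fun w => ?_
    cases w with
    | none => exact measurable_const
    | some j =>
      refine Measurable.ite (measurable_fst (S.measurableSet_conform_apply z j)) ?_
        measurable_const
      refine Measurable.ite (measurable_fst (S.measurableSet_conform z)) ?_ measurable_const
      exact Measurable.ite (measurableSet_lt (measurable_subtype_coe.comp measurable_snd)
        measurable_const) measurable_const measurable_const
  exact this.comp ((measurable_fst.comp measurable_snd).prodMk
    (measurable_fst.prodMk (measurable_snd.comp measurable_snd)))

theorem measurable_next_mean (z : Phase) (O : Fin n → Offer F) (w : Choice n) :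
    Measurable fun m => S.next z (O, w, m) :=
  S.measurable_next.comp
    (measurable_const.prodMk (measurable_const.prodMk (measurable_const.prodMk measurable_id)))

theorem measurable_phaseAt : ∀ t, Measurable (S.phaseAt t)
  | 0 => measurable_const
  | t + 1 => by
    have h1 : Measurable fun h : History F n (t + 1) =>
        (Fin.init (α := fun _ => Stage F n) h : History F n t) :=
      measurable_pi_lambda _ fun i => measurable_pi_apply _
    exact S.measurable_next.comp
      (((measurable_phaseAt t).comp h1).prodMk (measurable_pi_apply (Fin.last t)))

variable [IsProbabilityMeasure F]

open Classical in
/-- The agent's value of a purchase decision if some broker does not make the standing offer. -/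
def offValue (z : Phase) (O : Fin n → Offer F) (w : Choice n) : ℝ :=
  match w with
  | none => optionValue (S.value .punish) (nullSignal F : Measure unitInterval)
  | some j =>
    if O j = S.standing z then
      optionValue (S.value .reward) (S.sig z : Measure unitInterval) - S.fee z
    else optionValue (S.value .punish) ((O j).2 : Measure unitInterval) - (O j).1

theorem measurable_offValue (z : Phase) (w : Choice n) :
    Measurable fun O => S.offValue z O w := by
  cases w with
  | none => exact measurable_const
  | some j =>
    refine Measurable.ite (S.measurableSet_conform_apply z j) measurable_const ?_
    have hj : Measurable fun O : Fin n → Offer F => O j := measurable_pi_apply j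
    exact ((measurable_optionValue _).comp
      (measurable_subtype_coe.comp (measurable_snd.comp hj))).sub
      (measurable_subtype_coe.comp (measurable_fst.comp hj))

theorem exists_best (z : Phase) (O : Fin n → Offer F) :
    ∃ w, ∀ w', S.offValue z O w' ≤ S.offValue z O w :=
  Finite.exists_max (S.offValue z O)

/-- The maximizers of the agent's value. -/
def bestSet (z : Phase) (O : Fin n → Offer F) : Choice n → Prop :=
  fun w => ∀ w', S.offValue z O w' ≤ S.offValue z O w

/-- A selection from a set of purchase decisions. -/
def select (p : Choice n → Prop) : Choice n := Classical.epsilon p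

/-- A measurable selection of a maximizer of the agent's value. -/
def best (z : Phase) (O : Fin n → Offer F) : Choice n := select (S.bestSet z O)

theorem offValue_le_best (z : Phase) (O : Fin n → Offer F) (w : Choice n) :
    S.offValue z O w ≤ S.offValue z O (S.best z O) :=
  Classical.epsilon_spec (S.exists_best z O) w

theorem measurable_best (z : Phase) : Measurable (S.best z) := by
  have h1 : Measurable (S.bestSet z) := by
    refine measurable_pi_lambda _ fun w => ?_
    refine measurableSet_setOfPred.1 ?_
    have : {O : Fin n → Offer F | ∀ w', S.offValue z O w' ≤ S.offValue z O w} =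
        ⋂ w', {O | S.offValue z O w' ≤ S.offValue z O w} := by ext; simp
    exact this ▸ MeasurableSet.iInter fun w' =>
      measurableSet_le (S.measurable_offValue z w') (S.measurable_offValue z w)
  -- The set of maximizers takes values in a finite discrete space, where any selection is
  -- measurable.
  exact (Measurable.of_discrete (f := select)).comp h1

open Classical in
/-- The agent's purchase decision. -/
def purchase (z : Phase) (O : Fin n → Offer F) : PMF (Choice n) :=
  if ∀ i, O i = S.standing z then S.lottery.map some else PMF.pure (S.best z O)

theorem measurable_purchase (w : Choice n) :
    Measurable fun x : Phase × (Fin n → Offer F) => S.purchase x.1 x.2 w := by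
  classical
  refine measurable_from_prod_countable_right fun z => ?_
  have : (fun O => S.purchase z O w) = fun O =>
      if ∀ i, O i = S.standing z then S.lottery.map some w else
        if w = S.best z O then 1 else 0 := by
    funext O
    unfold purchase
    split_ifs <;> simp_all [PMF.pure_apply]
  simp only
  rw [this]
  refine Measurable.ite (S.measurableSet_conform z) measurable_const
    (Measurable.ite ?_ measurable_const measurable_const)
  have : {O | w = S.best z O} = S.best z ⁻¹' {w} := by ext; simp [eq_comm]
  exact this ▸ S.measurable_best z (MeasurableSet.of_discrete)

open Classical in
/-- The agent's decision to continue. -/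
def continuation (z : Phase) (s : Stage F n) : unitInterval :=
  if (s.2.2 : ℝ) < S.value (S.next z s) then 1 else 0

omit [IsProbabilityMeasure F] in
theorem measurable_continuation :
    Measurable fun x : Phase × Stage F n => S.continuation x.1 x.2 := by
  refine Measurable.ite (measurableSet_lt ?_ ?_) measurable_const measurable_const
  · exact measurable_subtype_coe.comp
      (measurable_snd.comp (measurable_snd.comp measurable_snd))
  · exact (Measurable.of_discrete (f := S.value)).comp S.measurable_next

/-- The strategy profile of a scheme. -/
def profile : Profile F n where
  broker _ :=
    { offer := fun t => Kernel.deterministic (fun h => S.standing (S.phaseAt t h))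
        ((Measurable.of_discrete (f := S.standing)).comp (S.measurable_phaseAt t))
      markov := fun _ => inferInstance }
  agent :=
    { buy := fun t h O => S.purchase (S.phaseAt t h) O
      measurable_buy := fun t w => (S.measurable_purchase w).comp
        (((S.measurable_phaseAt t).comp measurable_fst).prodMk measurable_snd)
      cont := fun t h s => S.continuation (S.phaseAt t h) s
      measurable_cont := fun t => S.measurable_continuation.comp
        (((S.measurable_phaseAt t).comp measurable_fst).prodMk measurable_snd) }

/-- The conditions under which the profile of a scheme is an equilibrium. -/
structure IsIncentiveCompatible (k : ℝ) : Prop where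
  cost_pos : 0 < k
  two_le : 2 ≤ n
  fee_reward : S.fee .reward = 0
  fee_punish : S.fee .punish = 0
  value_le_one : ∀ z, S.value z ≤ 1
  value_punish_nonneg : 0 ≤ S.value .punish
  value_punish : S.value .punish + k = priorMean F
  le_value : ∀ z, priorMean F ≤ S.value z + k
  value_eq : ∀ z, ∫ m : unitInterval, max (m : ℝ)
    (if (m : ℝ) < S.threshold z then S.value .reward else S.value .punish)
      ∂(S.sig z : Measure unitInterval) = S.value z + k + S.fee z
  deterrence : ∀ z, optionValue (S.value .punish) F + S.fee z <
    optionValue (S.value .reward) (S.sig z : Measure unitInterval)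

open Classical in
/-- The agent's value, gross of the search cost, after the offers `O`. -/
def stageValue (k : ℝ) (z : Phase) (O : Fin n → Offer F) : ℝ :=
  if ∀ i, O i = S.standing z then S.value z + k else S.offValue z O (S.best z O)

/-! ### One-step values of purchase decisions -/

section Values

variable {S} {k : ℝ} (hS : S.IsIncentiveCompatible k)
include hS

omit [IsProbabilityMeasure F] in
theorem IsIncentiveCompatible.value_nonneg (z : Phase) : 0 ≤ S.value z := by
  have h1 := hS.value_punish
  have h2 := hS.le_value z
  have h3 := hS.value_punish_nonneg
  linarith

omit [IsProbabilityMeasure F] in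
-- No transition leads to the target phase, so nothing is paid on schedule after the first period.
theorem IsIncentiveCompatible.fee_next (z : Phase) (s : Stage F n) : S.fee (S.next z s) = 0 := by
  unfold next
  split
  · exact hS.fee_punish
  · split_ifs <;> first | exact hS.fee_punish | exact hS.fee_reward

theorem IsIncentiveCompatible.optionValue_null :
    optionValue (S.value .punish) (nullSignal F : Measure unitInterval) = priorMean F := by
  have h1 := hS.value_punish
  have h2 := hS.cost_pos
  have := optionValue_prior (F := F) (S.value .punish)
  rw [max_eq_left (by linarith)] at this
  exact this

theorem IsIncentiveCompatible.stageValue_nonneg (z : Phase) (O : Fin n → Offer F) :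
    0 ≤ S.stageValue k z O := by
  unfold stageValue
  have := (priorMean_mem F).1
  split_ifs
  · exact this.trans (hS.le_value z)
  · refine this.trans (le_trans ?_ (S.offValue_le_best z O none))
    exact hS.optionValue_null.ge

theorem IsIncentiveCompatible.lintegral_eq (z : Phase) (O : Fin n → Offer F) (w : Choice n) :
    ∫⁻ m, max (ENNReal.ofReal (m : ℝ)) (ENNReal.ofReal (S.value (S.next z (O, w, m))))
      ∂(signal O w) =
    ENNReal.ofReal (∫ m, max (m : ℝ) (S.value (S.next z (O, w, m))) ∂(signal O w)) :=
  lintegral_max_ofReal ((Measurable.of_discrete (f := S.value)).comp (S.measurable_next_mean z O w))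
    (fun _ => hS.value_le_one _)

omit hS in
-- After a departure from the standing offers the next phase depends on the chosen offer alone, so
-- the continuation value is constant in the posterior mean.
theorem integral_eq_offValue {z : Phase} {O : Fin n → Offer F}
    (hO : ¬ ∀ i, O i = S.standing z) (w : Choice n) :
    ∫ m, max (m : ℝ) (S.value (S.next z (O, w, m))) ∂(signal O w) =
      S.offValue z O w + (price O w : ℝ) := by
  cases w with
  | none => simp [next, offValue, signal, price, nullSignal, optionValue]
  | some j =>
    by_cases hj : O j = S.standing z
    · have h1 : (O j).1 = S.fee z := by rw [hj]; rfl
      have h2 : (O j).2 = S.sig z := by rw [hj]; rfl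
      simp only [next, offValue, signal, price, hj, hO, if_true, if_false, optionValue]
      simp [standing]
    · simp [next, offValue, signal, price, hj, optionValue]

theorem IsIncentiveCompatible.integral_eq_some {z : Phase} {O : Fin n → Offer F}
    (hO : ∀ i, O i = S.standing z) (j : Fin n) :
    ∫ m, max (m : ℝ) (S.value (S.next z (O, some j, m))) ∂(signal O (some j)) =
      S.value z + k + (price O (some j) : ℝ) := by
  have h1 : price O (some j) = S.fee z := by simp only [price]; rw [hO j]; rfl
  have h2 : signal O (some j) = S.sig z := by simp only [signal]; rw [hO j]; rfl
  rw [h1, h2, ← hS.value_eq z]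
  congr 1
  funext m
  simp only [next]
  rw [if_pos (hO j), if_pos hO]
  split_ifs <;> rfl

theorem IsIncentiveCompatible.integral_none (z : Phase) (O : Fin n → Offer F) :
    ∫ m, max (m : ℝ) (S.value (S.next z (O, none, m))) ∂(signal O none) = priorMean F :=
  hS.optionValue_null

/-- The Bellman inequality. At standing offers, `le_value` covers the null offer and `value_eq` the
purchases; otherwise `best` maximizes by construction. -/
theorem IsIncentiveCompatible.lintegral_le (z : Phase) (O : Fin n → Offer F) (w : Choice n) :
    ∫⁻ m, max (ENNReal.ofReal (m : ℝ)) (ENNReal.ofReal (S.value (S.next z (O, w, m))))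
      ∂(signal O w) ≤ ENNReal.ofReal (S.stageValue k z O) + price O w := by
  rw [hS.lintegral_eq, ← ENNReal.ofReal_coe_nnreal (p := price O w),
    ← ENNReal.ofReal_add (hS.stageValue_nonneg z O) (NNReal.coe_nonneg _)]
  refine ENNReal.ofReal_le_ofReal ?_
  by_cases hO : ∀ i, O i = S.standing z
  · rw [stageValue, if_pos hO]
    cases w with
    | none =>
      rw [hS.integral_none]
      have := hS.le_value z
      simpa [price] using this
    | some j => rw [hS.integral_eq_some hO]
  · rw [integral_eq_offValue hO, stageValue, if_neg hO]
    have := S.offValue_le_best z O w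
    linarith

/-- The decisions actually used attain the Bellman bound: the lottery never picks the null offer,
and all standing offers are equivalent. -/
theorem IsIncentiveCompatible.lintegral_eq_of_purchase {z : Phase} {O : Fin n → Offer F}
    {w : Choice n} (hw : S.purchase z O w ≠ 0) :
    ∫⁻ m, max (ENNReal.ofReal (m : ℝ)) (ENNReal.ofReal (S.value (S.next z (O, w, m))))
      ∂(signal O w) = ENNReal.ofReal (S.stageValue k z O) + price O w := by
  rw [hS.lintegral_eq, ← ENNReal.ofReal_coe_nnreal (p := price O w),
    ← ENNReal.ofReal_add (hS.stageValue_nonneg z O) (NNReal.coe_nonneg _)]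
  congr 1
  by_cases hO : ∀ i, O i = S.standing z
  · rw [purchase, if_pos hO] at hw
    rw [stageValue, if_pos hO]
    cases w with
    | none => simp [PMF.map_apply] at hw
    | some j => rw [hS.integral_eq_some hO]
  · rw [purchase, if_neg hO] at hw
    rw [integral_eq_offValue hO, stageValue, if_neg hO]
    have : w = S.best z O := by
      by_contra hne
      exact hw (by simp [PMF.pure_apply, hne])
    rw [this]

/-- A lone deviator does not sell. -/
theorem IsIncentiveCompatible.best_ne {z : Phase} {O : Fin n → Offer F} {i : Fin n}
    (hO : ∀ j ≠ i, O j = S.standing z) (hi : O i ≠ S.standing z) : S.best z O ≠ some i := by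
  intro hb
  have : Nontrivial (Fin n) := Fin.nontrivial_iff_two_le.2 hS.two_le
  -- Buying from the rival j leads to the reward phase; by `deterrence` this beats even full
  -- information given away by the deviator.
  obtain ⟨j, hj⟩ := exists_ne i
  have h1 := S.offValue_le_best z O (some j)
  rw [hb] at h1
  simp only [offValue] at h1
  rw [if_pos (hO j hj), if_neg hi] at h1
  have h2 := optionValue_le (O i).2 (S.value .punish)
  have h3 := hS.deterrence z
  have h4 := (O i).1.2
  have h5 : (0 : ℝ) ≤ ((O i).1 : ℝ) := h4
  linarith

end Values

end Scheme

theorem pi_dirac_eq {ι : Type*} [Fintype ι] {α : ι → Type*} [∀ i, MeasurableSpace (α i)]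
    (x : ∀ i, α i) : Measure.pi (fun i => Measure.dirac (x i)) = Measure.dirac x := by
  refine Measure.pi_eq fun s hs => ?_
  rw [Measure.dirac_apply' _ (MeasurableSet.univ_pi hs)]
  simp_rw [fun i => Measure.dirac_apply' (x i) (hs i)]
  classical
  by_cases h : ∀ i, x i ∈ s i
  · rw [Set.indicator_of_mem (Set.mem_univ_pi.2 h)]
    exact (Finset.prod_eq_one fun i _ => by rw [Set.indicator_of_mem (h i)]; rfl).symm
  · rw [Set.indicator_of_notMem (fun h' => h (Set.mem_univ_pi.1 h'))]
    push Not at h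
    obtain ⟨i, hi⟩ := h
    exact (Finset.prod_eq_zero (Finset.mem_univ i) (Set.indicator_of_notMem hi _)).symm

/-! ### Play of the profile and its optimality -/

namespace Scheme

variable {F : Measure unitInterval} [IsProbabilityMeasure F] {n : ℕ} (S : Scheme F n) {k : ℝ}

/-- The standing offers of all brokers after a history. -/
def standingOffers (t : ℕ) (h : History F n t) : Fin n → Offer F :=
  fun _ => S.standing (S.phaseAt t h)

theorem offerLaw_profile (t : ℕ) (h : History F n t) :
    offerLaw S.profile t h = Measure.dirac (S.standingOffers t h) := by
  unfold offerLaw profile standingOffers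
  simp only [Kernel.deterministic_apply]
  exact pi_dirac_eq _

theorem stageValue_standingOffers (t : ℕ) (h : History F n t) :
    S.stageValue k (S.phaseAt t h) (S.standingOffers t h) = S.value (S.phaseAt t h) + k :=
  if_pos fun _ => rfl

theorem contProb_profile (t : ℕ) (h : History F n t) (s : Stage F n) :
    contProb S.profile t h s = ENNReal.ofReal (S.continuation (S.phaseAt t h) s) := rfl

/-- The prescribed stopping rule compares the posterior mean with the next phase's value, so it
attains the bound of `consumption_add_le`. -/
theorem consumption_add_eq (t : ℕ) (h : History F n t) (s : Stage F n) :
    consumption S.profile t h s + contProb S.profile t h s *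
        ENNReal.ofReal (S.value (S.phaseAt (t + 1) (extend h s))) =
      max (ENNReal.ofReal (s.2.2 : ℝ))
        (ENNReal.ofReal (S.value (S.next (S.phaseAt t h) s))) := by
  rw [phaseAt_extend, contProb_profile]
  have h1 : stopProb S.profile t h s
      = ENNReal.ofReal (1 - (S.continuation (S.phaseAt t h) s : ℝ)) := rfl
  rw [consumption, h1, continuation]
  split_ifs with hlt
  · rw [max_eq_right (ENNReal.ofReal_le_ofReal hlt.le)]; simp
  · rw [max_eq_left (ENNReal.ofReal_le_ofReal (not_lt.1 hlt))]; simp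

/-- Play depends on the past only through the phase. As phases are discrete, this yields the
measurability of survival that the lower bound requires. -/
theorem exists_survival_eq (N : ℕ) : ∃ f : Phase → ℝ≥0∞, ∀ t (h : History F n t),
    survival S.profile N t h = f (S.phaseAt t h) := by
  induction N with
  | zero => exact ⟨fun _ => 1, fun _ _ => rfl⟩
  | succ N ih =>
    obtain ⟨f, hf⟩ := ih
    refine ⟨fun z => ∑ w, S.purchase z (fun _ => S.standing z) w *
      ∫⁻ m, ENNReal.ofReal (S.continuation z (fun _ => S.standing z, w, m)) *
        f (S.next z (fun _ => S.standing z, w, m)) ∂(signal (fun _ => S.standing z) w),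
      fun t h => ?_⟩
    rw [survival, offerLaw_profile, lintegral_dirac]
    unfold expectStage
    simp_rw [hf, phaseAt_extend, contProb_profile]
    rfl

theorem measurable_survival (N t : ℕ) (h : History F n t) (O : Fin n → Offer F) (w : Choice n) :
    Measurable fun m => survival S.profile N (t + 1) (extend h (O, w, m)) := by
  obtain ⟨f, hf⟩ := S.exists_survival_eq N
  simp_rw [hf, phaseAt_extend]
  exact (Measurable.of_discrete (f := f)).comp (S.measurable_next_mean _ O w)

omit [IsProbabilityMeasure F] in
theorem measurable_value (t : ℕ) (h : History F n t) (O : Fin n → Offer F) (w : Choice n) :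
    Measurable fun m => ENNReal.ofReal (S.value (S.phaseAt (t + 1) (extend h (O, w, m)))) := by
  simp_rw [phaseAt_extend]
  exact ((Measurable.of_discrete (f := S.value)).comp
    (S.measurable_next_mean _ O w)).ennreal_ofReal

/-! ### Optimality for the agent -/

section Agent

variable {S} (hS : S.IsIncentiveCompatible k)
include hS

theorem IsIncentiveCompatible.total_le (τ : AgentStrategy F n) (t : ℕ) (h : History F n t) :
    expectedTotal (S.profile.deviateAgent τ) (consumption (S.profile.deviateAgent τ)) t h ≤
      ENNReal.ofReal (S.value (S.phaseAt t h)) +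
        expectedTotal (S.profile.deviateAgent τ) (fun _ _ => expense k) t h := by
  refine expectedTotal_consumption_le
    (W := fun t h => ENNReal.ofReal (S.value (S.phaseAt t h))) S.measurable_value ?_ t h
  intro t h
  have h1 : offerLaw (S.profile.deviateAgent τ) t h = Measure.dirac (S.standingOffers t h) :=
    S.offerLaw_profile t h
  rw [h1, ae_dirac_eq]
  intro w
  have := hS.lintegral_le (S.phaseAt t h) (S.standingOffers t h) w
  rw [stageValue_standingOffers, ENNReal.ofReal_add (hS.value_nonneg _) hS.cost_pos.le] at this
  simpa only [phaseAt_extend] using this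

theorem IsIncentiveCompatible.le_total (t : ℕ) (h : History F n t) :
    ENNReal.ofReal (S.value (S.phaseAt t h)) +
        expectedTotal S.profile (fun _ _ => expense k) t h ≤
      expectedTotal S.profile (consumption S.profile) t h ∧
        expectedTotal S.profile (fun _ _ => expense k) t h ≠ ∞ := by
  refine le_expectedTotal_consumption
    (W := fun t h => ENNReal.ofReal (S.value (S.phaseAt t h))) hS.cost_pos S.offerLaw_profile
    (fun t h => ENNReal.ofReal_le_one.2 (hS.value_le_one _)) S.measurable_value
    S.measurable_survival ?_ t h
  intro t h w hw
  have := hS.lintegral_eq_of_purchase (z := S.phaseAt t h) (O := S.standingOffers t h) hw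
  rw [stageValue_standingOffers, ENNReal.ofReal_add (hS.value_nonneg _) hS.cost_pos.le] at this
  simp_rw [consumption_add_eq]
  exact this.ge

theorem IsIncentiveCompatible.agentPayoff_le (τ : AgentStrategy F n) (t : ℕ)
    (h : History F n t) :
    agentPayoff k (S.profile.deviateAgent τ) t h ≤ (S.value (S.phaseAt t h) : EReal) := by
  have h1 := hS.total_le τ t h
  rw [← add_zero (expectedTotal _ (consumption _) t h)] at h1
  have := coe_sub_coe_le (hS.value_nonneg (S.phaseAt t h)) ENNReal.zero_ne_top h1
  unfold agentPayoff
  simpa only [ENNReal.toReal_zero, sub_zero] using this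

theorem IsIncentiveCompatible.agentPayoff_eq (t : ℕ) (h : History F n t) :
    agentPayoff k S.profile t h = (S.value (S.phaseAt t h) : EReal) := by
  refine le_antisymm (hS.agentPayoff_le S.profile.agent t h) ?_
  obtain ⟨h1, h2⟩ := hS.le_total t h
  rw [← add_zero (expectedTotal _ (consumption _) t h)] at h1
  have := le_coe_sub_coe (hS.value_nonneg (S.phaseAt t h)) ENNReal.zero_ne_top h2 h1
  unfold agentPayoff
  simpa only [ENNReal.toReal_zero, sub_zero] using this

/-- The upper bound for any deviation and the lower bound for the profile meet at `stageValue` minus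
k, whatever the current offers. -/
theorem IsIncentiveCompatible.agent_optimal_buy (τ : AgentStrategy F n) (t : ℕ)
    (h : History F n t) (O : Fin n → Offer F) :
    agentPayoffAfterOffers k (S.profile.deviateAgent τ) t h O ≤
      agentPayoffAfterOffers k S.profile t h O := by
  have hval := hS.stageValue_nonneg (S.phaseAt t h) O
  have h1 := expectStage_consumption_le (σ := S.profile.deviateAgent τ) (t := t) (h := h) (O := O)
    (k := k) (V := ENNReal.ofReal (S.stageValue k (S.phaseAt t h) O))
    (W := fun s => ENNReal.ofReal (S.value (S.phaseAt (t + 1) (extend h s))))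
    (S.measurable_value t h O) (fun w _ => by
      simpa only [phaseAt_extend] using hS.lintegral_le (S.phaseAt t h) O w)
    (fun s => hS.total_le τ (t + 1) (extend h s))
  have h2 := le_expectStage_consumption (σ := S.profile) (t := t) (h := h) (O := O) (k := k)
    (V := ENNReal.ofReal (S.stageValue k (S.phaseAt t h) O)) (r := fun _ => 0)
    (W := fun s => ENNReal.ofReal (S.value (S.phaseAt (t + 1) (extend h s))))
    (c := fun s => expectedTotal S.profile (consumption S.profile) (t + 1) (extend h s))
    (x := fun s => expectedTotal S.profile (fun _ _ => expense k) (t + 1) (extend h s))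
    (S.measurable_value t h O) (fun _ => measurable_const) (fun w hw => by
      simp_rw [consumption_add_eq]
      exact (hS.lintegral_eq_of_purchase hw).ge)
    (fun s => by rw [add_zero]; exact (hS.le_total (t + 1) (extend h s)).1)
  have h3 : expectStage S.profile t h O (fun s => contProb S.profile t h s * 0) = 0 := by
    simp [expectStage]
  rw [h3, add_zero] at h2
  refine (coe_sub_coe_le hval ENNReal.ofReal_ne_top h1).trans
    (le_coe_sub_coe hval ENNReal.ofReal_ne_top ?_ h2)
  refine ne_top_of_le_ne_top ?_ (le_add_self.trans h2)
  refine ENNReal.add_ne_top.2 ⟨?_, ENNReal.ofReal_ne_top⟩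
  exact ne_top_of_le_ne_top ENNReal.one_ne_top (totalAfterOffers_consumption_le_one t h O)

theorem IsIncentiveCompatible.agent_optimal_stop (τ : AgentStrategy F n) (t : ℕ)
    (h : History F n t) (s : Stage F n) :
    agentPayoffAfterStage k (S.profile.deviateAgent τ) t h s ≤
      agentPayoffAfterStage k S.profile t h s := by
  set M : ℝ := max (s.2.2 : ℝ) (S.value (S.next (S.phaseAt t h) s)) with hM
  have hM0 : 0 ≤ M := le_max_of_le_left s.2.2.2.1
  have hMr : ENNReal.ofReal M = max (ENNReal.ofReal (s.2.2 : ℝ))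
      (ENNReal.ofReal (S.value (S.next (S.phaseAt t h) s))) := ENNReal.ofReal_max _ _
  have he : expense k s ≠ ∞ :=
    ENNReal.add_ne_top.2 ⟨ENNReal.ofReal_ne_top, ENNReal.coe_ne_top⟩
  refine (coe_sub_coe_le hM0 he ?_).trans (le_coe_sub_coe hM0 he ?_ ?_)
  · have h1 := hS.total_le τ (t + 1) (extend h s)
    rw [phaseAt_extend] at h1
    unfold totalAfterStage
    calc _ ≤ consumption (S.profile.deviateAgent τ) t h s
            + contProb (S.profile.deviateAgent τ) t h s *
              (ENNReal.ofReal (S.value (S.next (S.phaseAt t h) s)) + expectedTotal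
                (S.profile.deviateAgent τ) (fun _ _ => expense k) (t + 1) (extend h s))
            + expense k s := by gcongr
      _ = (consumption (S.profile.deviateAgent τ) t h s
            + contProb (S.profile.deviateAgent τ) t h s *
              ENNReal.ofReal (S.value (S.next (S.phaseAt t h) s))) +
            (expense k s + contProb (S.profile.deviateAgent τ) t h s * expectedTotal
                (S.profile.deviateAgent τ) (fun _ _ => expense k) (t + 1) (extend h s)) := by ring
      _ ≤ _ := by
        gcongr
        rw [hMr]
        exact consumption_add_le s _
  · refine ENNReal.add_ne_top.2 ⟨he, ENNReal.mul_ne_top ENNReal.ofReal_ne_top ?_⟩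
    exact (hS.le_total (t + 1) (extend h s)).2
  · have h1 := (hS.le_total (t + 1) (extend h s)).1
    unfold totalAfterStage
    rw [hMr, ← S.consumption_add_eq t h s]
    calc _ = consumption S.profile t h s + contProb S.profile t h s *
          (ENNReal.ofReal (S.value (S.phaseAt (t + 1) (extend h s))) + expectedTotal
            S.profile (fun _ _ => expense k) (t + 1) (extend h s)) + expense k s := by ring
      _ ≤ _ := by gcongr

end Agent

/-! ### Optimality for the brokers -/

section Broker

theorem ae_conform (i : Fin n) (τ : BrokerStrategy F n) (t : ℕ) (h : History F n t) :
    ∀ᵐ O ∂(offerLaw (S.profile.deviateBroker i τ) t h),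
      ∀ j ≠ i, O j = S.standing (S.phaseAt t h) := by
  have : ∀ j, IsMarkovKernel (((S.profile.deviateBroker i τ).broker j).offer t) :=
    fun j => ((S.profile.deviateBroker i τ).broker j).markov t
  rw [ae_all_iff]
  intro j
  by_cases hj : j = i
  · exact Filter.Eventually.of_forall fun _ h => (h hj).elim
  have hlaw : ((S.profile.deviateBroker i τ).broker j).offer t h =
      Measure.dirac (S.standing (S.phaseAt t h)) := by
    simp only [Profile.deviateBroker, Function.update_of_ne hj, profile,
      Kernel.deterministic_apply]
  have h1 : ∀ᵐ o ∂(((S.profile.deviateBroker i τ).broker j).offer t h),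
      o = S.standing (S.phaseAt t h) := by
    rw [hlaw, ae_dirac_eq]; exact rfl
  filter_upwards [(Measure.tendsto_eval_ae_ae (μ := fun j =>
    ((S.profile.deviateBroker i τ).broker j).offer t h) (i := j)).eventually h1] with O hO _
  exact hO

omit [IsProbabilityMeasure F] in
theorem lottery_map_some (i : Fin n) : S.lottery.map some (some i) = S.lottery i := by
  rw [PMF.map_apply, tsum_eq_single i fun j hj => by simp [hj.symm]]; simp

variable {S} (hS : S.IsIncentiveCompatible k)
include hS

/-- A conforming broker sells with her lottery probability; a lone deviator does not sell at all. -/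
theorem IsIncentiveCompatible.sum_purchase_revenue {z : Phase} {O : Fin n → Offer F} {i : Fin n}
    (hO : ∀ j ≠ i, O j = S.standing z) (m : Choice n → unitInterval) :
    ∑ w, S.purchase z O w * revenue i (O, w, m w) ≤ S.lottery i * S.fee z := by
  rw [Finset.sum_eq_single (some i) (fun w _ hw => by simp [revenue, hw]) (by simp)]
  by_cases hi : O i = S.standing z
  · have hall : ∀ j, O j = S.standing z := fun j => by
      by_cases hj : j = i
      · rw [hj]; exact hi
      · exact hO j hj
    rw [purchase, if_pos hall, lottery_map_some]
    simp [revenue, hi, standing]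
  · rw [purchase, if_neg fun hall => hi (hall i), PMF.pure_apply,
      if_neg (hS.best_ne hO hi).symm, zero_mul]
    exact zero_le

theorem IsIncentiveCompatible.expectedSum_revenue_le (i : Fin n) (τ : BrokerStrategy F n) :
    ∀ (N t : ℕ) (h : History F n t),
      expectedSum (S.profile.deviateBroker i τ) (fun _ _ => revenue i) N t h ≤
        S.lottery i * S.fee (S.phaseAt t h)
  | 0, _, _ => zero_le
  | N + 1, t, h => by
    refine expectedSum_succ_le_of_ae ?_
    filter_upwards [S.ae_conform i τ t h] with O hO
    -- The inductive bound is zero here, because every next phase has zero fee.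
    have hnext : ∀ s, expectedSum (S.profile.deviateBroker i τ) (fun _ _ => revenue i) N (t + 1)
        (extend h s) = 0 := fun s => by
      have := IsIncentiveCompatible.expectedSum_revenue_le i τ N (t + 1) (extend h s)
      rw [phaseAt_extend, hS.fee_next] at this
      simpa using this
    simp_rw [hnext, mul_zero, add_zero]
    refine le_trans (le_of_eq ?_) (hS.sum_purchase_revenue hO fun _ => 0)
    unfold expectStage
    refine Finset.sum_congr rfl fun w _ => ?_
    have : ∀ m, revenue i (O, w, m) = revenue i (O, w, 0) := fun _ => rfl
    simp_rw [this]
    rw [lintegral_const, measure_univ, mul_one]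
    rfl

theorem IsIncentiveCompatible.brokerPayoff_eq (i : Fin n) (t : ℕ) (h : History F n t) :
    brokerPayoff S.profile i t h = S.lottery i * S.fee (S.phaseAt t h) := by
  refine le_antisymm (iSup_le fun N => ?_) ?_
  · have := hS.expectedSum_revenue_le i (S.profile.broker i) N t h
    rwa [Profile.deviateBroker, Function.update_eq_self] at this
  · refine le_trans (le_of_eq ?_) (expectedSum_le_expectedTotal _ 1 t h)
    rw [expectedSum, offerLaw_profile, lintegral_dirac]
    simp only [expectedSum, mul_zero, add_zero]
    unfold expectStage
    rw [Finset.sum_eq_single (some i) (fun w _ hw => by simp [revenue, hw]) (by simp)]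
    have h1 : S.profile.agent.buy t h (S.standingOffers t h) (some i) = S.lottery i := by
      have : S.profile.agent.buy t h (S.standingOffers t h) = S.lottery.map some :=
        if_pos fun _ => rfl
      rw [this, lottery_map_some]
    rw [h1]
    simp [revenue, standingOffers, standing]

/-- The profile of an incentive compatible scheme is an equilibrium. -/
theorem IsIncentiveCompatible.isEquilibrium : IsEquilibrium k S.profile where
  broker_optimal i τ t h := by
    rw [hS.brokerPayoff_eq]
    exact iSup_le fun N => hS.expectedSum_revenue_le i τ N t h
  agent_optimal τ t h := by
    rw [hS.agentPayoff_eq]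
    exact hS.agentPayoff_le τ t h
  agent_optimal_buy := hS.agent_optimal_buy
  agent_optimal_stop := hS.agent_optimal_stop

end Broker

end Scheme

/-! ### A single broker -/

section Monopoly

variable {F : Measure unitInterval} [IsProbabilityMeasure F] {n : ℕ} {k : ℝ}

theorem optionValue_signal_le (O : Fin n → Offer F) (w : Choice n) (u : ℝ) :
    optionValue u (signal O w) ≤ u + searchGain F u := by
  rw [← optionValue_full (F := F)]
  cases w with
  | none => exact optionValue_le (nullSignal F) u
  | some j => exact optionValue_le (O j).2 u

/-- No strategy profile gives the agent more than search with free full information. -/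
theorem expectedTotal_le_mcCallPayoff (hk : 0 < k) (hkm : k < priorMean F) (σ : Profile F n)
    (t : ℕ) (h : History F n t) :
    expectedTotal σ (consumption σ) t h ≤
      ENNReal.ofReal (mcCallPayoff F k) + expectedTotal σ (fun _ _ => expense k) t h := by
  obtain ⟨h1, h2, h3⟩ := mcCallPayoff_spec hk hkm
  refine expectedTotal_consumption_le (W := fun _ _ => ENNReal.ofReal (mcCallPayoff F k))
    (fun _ _ _ _ => measurable_const) (fun t h => Filter.Eventually.of_forall fun O w => ?_) t h
  rw [lintegral_max_ofReal measurable_const fun _ => h3,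
    ← ENNReal.ofReal_add (by linarith) hk.le]
  refine le_trans (ENNReal.ofReal_le_ofReal ?_) le_self_add
  have := optionValue_signal_le O w (mcCallPayoff F k)
  rwa [h1] at this

/-- The agent who is informed at once, searches on at low posterior means, and then stops. -/
def informedOnce (F : Measure unitInterval) (u : ℝ) : AgentStrategy F 1 where
  buy t _ _ := if t = 0 then PMF.pure (some 0) else PMF.pure none
  measurable_buy _ _ := measurable_const
  cont t _ s := open Classical in if t = 0 ∧ (s.2.2 : ℝ) < u then 1 else 0
  measurable_cont t := by
    by_cases ht : t = 0
    · simp only [ht, true_and]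
      exact Measurable.ite (measurableSet_lt
        (measurable_subtype_coe.comp (measurable_snd.comp (measurable_snd.comp measurable_snd)))
        measurable_const) measurable_const measurable_const
    · simp only [ht, false_and, if_false]
      exact measurable_const

/-- The broker who always sells full information at the price `p`. -/
def fixedOffer (o : Offer F) (n : ℕ) : BrokerStrategy F n where
  offer _ := Kernel.const _ (Measure.dirac o)
  markov _ := inferInstance

/-- From the second period on the agent pays k once, takes the null offer and consumes at mean μ,
whatever the broker does. -/
theorem informedOnce_tail (hk : 0 < k) (hkm : k < priorMean F) (σ : Profile F 1) (u : ℝ)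
    (h : History F 1 1) :
    ENNReal.ofReal (priorMean F - k) +
        expectedTotal (σ.deviateAgent (informedOnce F u)) (fun _ _ => expense k) 1 h ≤
      expectedTotal (σ.deviateAgent (informedOnce F u))
        (consumption (σ.deviateAgent (informedOnce F u))) 1 h := by
  set σ' := σ.deviateAgent (informedOnce F u) with hσ'
  have hbuy : ∀ O, σ'.agent.buy 1 h O = PMF.pure none := fun O => by
    simp [hσ', Profile.deviateAgent, informedOnce]
  have hcont : ∀ s, σ'.agent.cont 1 h s = 0 := fun s => by
    simp [hσ', Profile.deviateAgent, informedOnce]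
  have hstage : ∀ O (f : Stage F 1 → ℝ≥0∞),
      expectStage σ' 1 h O f = ∫⁻ m, f (O, none, m) ∂(signal O none) := fun O f => by
    unfold expectStage
    rw [Finset.sum_eq_single none (fun w _ hw => by simp [hbuy, hw]) (by simp), hbuy]
    simp
  have hX : expectedTotal σ' (fun _ _ => expense k) 1 h ≤ ENNReal.ofReal k := by
    refine iSup_le fun N => ?_
    cases N with
    | zero => exact zero_le
    | succ N =>
      refine expectedSum_succ_le_of_ae (Filter.Eventually.of_forall fun O => ?_)
      rw [hstage]
      simp [contProb, hcont, expense, price]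
  have hC : ENNReal.ofReal (priorMean F) ≤ expectedTotal σ' (consumption σ') 1 h := by
    refine le_trans (le_of_eq ?_) (expectedSum_le_expectedTotal _ 1 1 h)
    rw [expectedSum]
    simp only [expectedSum, mul_zero, add_zero, hstage]
    simp [consumption, stopProb, hcont, signal]
  calc _ ≤ ENNReal.ofReal (priorMean F - k) + ENNReal.ofReal k := by gcongr
    _ = ENNReal.ofReal (priorMean F) := by
      rw [← ENNReal.ofReal_add (by linarith) hk.le]; simp
    _ ≤ _ := hC

/-- Accepting full information and continuing below μ - k is a guarantee independent of the profile,
since the fallback μ - k is secured by `informedOnce_tail`. -/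
theorem le_informedOnce (hk : 0 < k) (hkm : k < priorMean F) (σ : Profile F 1) {p : ℝ≥0}
    (hp : (p : ℝ) ≤ optionValue (priorMean F - k) F) :
    ((optionValue (priorMean F - k) F - p - k : ℝ) : EReal) ≤
      agentPayoffAfterOffers k (σ.deviateAgent (informedOnce F (priorMean F - k))) 0
        (emptyHistory F 1) (fun _ => (p, fullSignal F)) := by
  set σ' := σ.deviateAgent (informedOnce F (priorMean F - k)) with hσ'
  set O : Fin 1 → Offer F := fun _ => (p, fullSignal F) with hO
  have hbuy : σ'.agent.buy 0 (emptyHistory F 1) O = PMF.pure (some 0) := by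
    simp [hσ', Profile.deviateAgent, informedOnce]
  have hV : ∀ w, σ'.agent.buy 0 (emptyHistory F 1) O w ≠ 0 →
      ENNReal.ofReal (optionValue (priorMean F - k) F - p) + price O w ≤
      ∫⁻ m, (consumption σ' 0 (emptyHistory F 1) (O, w, m) +
        contProb σ' 0 (emptyHistory F 1) (O, w, m) * ENNReal.ofReal (priorMean F - k))
          ∂(signal O w) := by
    intro w hw
    obtain rfl : w = some 0 := by
      by_contra hne
      exact hw (by rw [hbuy, PMF.pure_apply, if_neg hne])
    have hpt : ∀ m : unitInterval, consumption σ' 0 (emptyHistory F 1) (O, some 0, m) +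
        contProb σ' 0 (emptyHistory F 1) (O, some 0, m) * ENNReal.ofReal (priorMean F - k) =
        max (ENNReal.ofReal (m : ℝ)) (ENNReal.ofReal (priorMean F - k)) := fun m => by
      by_cases hm : (m : ℝ) < priorMean F - k
      · have : σ'.agent.cont 0 (emptyHistory F 1) (O, some 0, m) = 1 := if_pos ⟨rfl, hm⟩
        rw [max_eq_right (ENNReal.ofReal_le_ofReal hm.le)]
        simp [consumption, stopProb, contProb, this]
      · have : σ'.agent.cont 0 (emptyHistory F 1) (O, some 0, m) = 0 := if_neg fun h => hm h.2
        rw [max_eq_left (ENNReal.ofReal_le_ofReal (not_lt.1 hm))]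
        simp [consumption, stopProb, contProb, this]
    simp_rw [hpt]
    have hμ := (priorMean_mem F).2
    rw [lintegral_max_ofReal measurable_const fun _ => by linarith]
    have h1 : price O (some 0) = p := rfl
    rw [h1, ← ENNReal.ofReal_coe_nnreal (p := p),
      ← ENNReal.ofReal_add (by linarith) (NNReal.coe_nonneg _), sub_add_cancel]
    exact le_rfl
  have h2 := le_expectStage_consumption (σ := σ') (k := k) (O := O) (h := emptyHistory F 1)
    (W := fun _ => ENNReal.ofReal (priorMean F - k)) (r := fun _ => 0)
    (c := fun s => expectedTotal σ' (consumption σ') 1 (extend (emptyHistory F 1) s))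
    (x := fun s => expectedTotal σ' (fun _ _ => expense k) 1 (extend (emptyHistory F 1) s))
    (fun _ => measurable_const) (fun _ => measurable_const) hV
    (fun s => by rw [add_zero]; exact informedOnce_tail hk hkm σ _ _)
  have h3 : expectStage σ' 0 (emptyHistory F 1) O
      (fun s => contProb σ' 0 (emptyHistory F 1) s * 0) = 0 := by
    simp [expectStage]
  rw [h3, add_zero] at h2
  have h4 := le_coe_sub_coe (by linarith) ENNReal.ofReal_ne_top
    (ne_top_of_le_ne_top (ENNReal.add_ne_top.2 ⟨ne_top_of_le_ne_top ENNReal.one_ne_top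
      (totalAfterOffers_consumption_le_one 0 (emptyHistory F 1) O), ENNReal.ofReal_ne_top⟩)
      (le_add_self.trans h2)) h2
  rwa [ENNReal.toReal_ofReal hk.le] at h4

/-- If a single broker may earn nothing in equilibrium, full information now, followed by search
without information, is not worth more than an uninformed purchase followed by free full
information. -/
theorem le_of_equilibriumPayoffs_eq (hk : 0 < k) (hkm : k < priorMean F)
    (hE : equilibriumPayoffs F 1 k = feasiblePayoffs F 1 k) :
    priorMean F - k + searchGain F (priorMean F - k) ≤
      max (priorMean F) (mcCallPayoff F k) := by
  obtain ⟨-, h2, h3⟩ := mcCallPayoff_spec hk hkm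
  -- The feasible profile that is hardest to sustain: the broker gets nothing.
  have hmem : (![0, mcCallPayoff F k] : Fin 2 → ℝ) ∈ feasiblePayoffs F 1 k := by
    refine ⟨fun j => ?_, ?_, ?_⟩
    · fin_cases j
      · simp
      · simp; linarith
    · simpa [autarkyPayoff, Fin.last] using h2
    · simp [Fin.sum_univ_two]
  rw [← hE] at hmem
  obtain ⟨σ, hσ, hb, -⟩ := hmem
  have hb0 : brokerPayoff σ 0 0 (emptyHistory F 1) = 0 := by
    have := hb 0
    simpa using this
  by_contra! hlt
  rw [← optionValue_full (F := F)] at hlt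
  set M := optionValue (priorMean F - k) (fullSignal F : Measure unitInterval) with hM
  set m₀ := max (priorMean F) (mcCallPayoff F k) with hm₀
  have hm₀0 : 0 ≤ m₀ := le_max_of_le_left (priorMean_mem F).1
  -- Half of the surplus: a positive price that still makes acceptance strictly better than refusal.
  set p : ℝ≥0 := ((M - m₀) / 2).toNNReal with hp
  have hpr : (p : ℝ) = (M - m₀) / 2 := Real.coe_toNNReal _ (by linarith)
  have hppos : 0 < p := Real.toNNReal_pos.2 (by linarith)
  set O : Fin 1 → Offer F := fun _ => (p, fullSignal F) with hO
  -- the broker's deviation is unprofitable only if the agent rejects it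
  have hrej : σ.agent.buy 0 (emptyHistory F 1) O (some 0) = 0 := by
    have h1 := hσ.broker_optimal 0 (fixedOffer (p, fullSignal F) 1) 0 (emptyHistory F 1)
    rw [hb0] at h1
    have h4 := (expectedSum_le_expectedTotal _ 1 0 (emptyHistory F 1)).trans h1
    have hlaw : offerLaw (σ.deviateBroker 0 (fixedOffer (p, fullSignal F) 1)) 0
        (emptyHistory F 1) = Measure.dirac O := by
      rw [← pi_dirac_eq]
      unfold offerLaw
      congr 1
      funext i
      obtain rfl : i = 0 := Subsingleton.elim _ _
      simp [Profile.deviateBroker, fixedOffer, hO]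
    rw [expectedSum, hlaw, lintegral_dirac] at h4
    simp only [expectedSum, mul_zero, add_zero, expectStage] at h4
    have h5 := (Finset.sum_eq_zero_iff.1 (le_antisymm h4 zero_le)) (some 0) (Finset.mem_univ _)
    rcases mul_eq_zero.1 h5 with h6 | h6
    · exact h6
    · simp [revenue, hO, hppos.ne'] at h6
  have hagent := hσ.agent_optimal_buy (informedOnce F (priorMean F - k)) 0 (emptyHistory F 1) O
  have hlow := le_informedOnce hk hkm σ (p := p) (by
    change (p : ℝ) ≤ M; rw [hpr]; linarith)
  have hup : agentPayoffAfterOffers k σ 0 (emptyHistory F 1) O ≤ ((m₀ - k : ℝ) : EReal) := by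
    have h1 := expectStage_consumption_le (σ := σ) (k := k) (O := O) (h := emptyHistory F 1)
      (V := ENNReal.ofReal m₀) (W := fun _ => ENNReal.ofReal (mcCallPayoff F k))
      (fun _ => measurable_const) (fun w hw => by
        have hw0 : w = none := by
          rcases w with _ | j
          · rfl
          · obtain rfl : j = 0 := Subsingleton.elim _ _
            exact (hw hrej).elim
        subst hw0
        refine le_trans (le_of_eq ?_) le_self_add
        rw [lintegral_max_ofReal measurable_const fun _ => h3]
        exact congrArg _ (optionValue_prior _))
      (fun s => expectedTotal_le_mcCallPayoff hk hkm σ 1 (extend (emptyHistory F 1) s))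
    have h4 := coe_sub_coe_le hm₀0 ENNReal.ofReal_ne_top h1
    rwa [ENNReal.toReal_ofReal hk.le] at h4
  have hfin := hlow.trans (hagent.trans hup)
  rw [EReal.coe_le_coe_iff] at hfin
  change M - (p : ℝ) - k ≤ m₀ - k at hfin
  linarith

end Monopoly

/-! ### Feasible payoffs as equilibrium payoffs -/

section Feasible

variable {F : Measure unitInterval} [IsProbabilityMeasure F] {n : ℕ} {k : ℝ}

/-- Probabilities proportional to the payoffs turn a common fee into any division of it; if the
total is zero, any lottery does. -/
theorem exists_lottery (hn : 1 < n) (x : Fin n → ℝ) (hx : ∀ i, 0 ≤ x i) :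
    ∃ q : PMF (Fin n), ∀ i, q i * ((∑ i, x i).toNNReal : ℝ≥0∞) = ENNReal.ofReal (x i) := by
  have hs : 0 ≤ ∑ i, x i := Finset.sum_nonneg fun i _ => hx i
  rcases hs.eq_or_lt with h | h
  · refine ⟨PMF.pure ⟨0, by omega⟩, fun i => ?_⟩
    have : x i = 0 := (Finset.sum_eq_zero_iff_of_nonneg fun i _ => hx i).1 h.symm i (Finset.mem_univ i)
    rw [← h, this]; simp
  · refine ⟨PMF.ofFintype (fun i => ENNReal.ofReal (x i / ∑ i, x i)) ?_, fun i => ?_⟩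
    · rw [← ENNReal.ofReal_sum_of_nonneg fun i _ => div_nonneg (hx i) hs, ← Finset.sum_div,
        div_self h.ne', ENNReal.ofReal_one]
    · rw [PMF.ofFintype_apply]
      change ENNReal.ofReal _ * ENNReal.ofReal _ = _
      rw [← ENNReal.ofReal_mul (div_nonneg (hx i) hs), div_mul_cancel₀ _ h.ne']

/-- A signal and a threshold that yield a given value to the agent on the path of play. -/
theorem exists_signal_threshold (hF : F ≪ volume) {u v V : ℝ} (R : Signal F)
    (h1 : optionValue u (R : Measure unitInterval) ≤ V) (h2 : V ≤ optionValue v F) :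
    ∃ (G : Signal F) (a : ℝ),
      ∫ m : unitInterval, max (m : ℝ) (if (m : ℝ) < a then v else u)
        ∂(G : Measure unitInterval) = V ∧
      optionValue v (R : Measure unitInterval) ≤ optionValue v (G : Measure unitInterval) := by
  -- Values up to that of full information without reward come from mixing R with full information;
  -- higher ones from full information with reward below a threshold. Both keep the signal at least
  -- as valuable as R under reward, so deterrence is inherited.
  rcases le_total V (optionValue u F) with h | h
  · have hseg : V ∈ segment ℝ (optionValue u (R : Measure unitInterval)) (optionValue u F) := by
      rw [segment_eq_Icc (h1.trans h)]; exact ⟨h1, h⟩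
    obtain ⟨a, b, ha, hb, hab, hV⟩ := hseg
    have hb1 : b ≤ 1 := by linarith
    refine ⟨mixSignal ⟨b, hb, hb1⟩ R (fullSignal F), 0, ?_, ?_⟩
    · have : ∀ m : unitInterval, (if (m : ℝ) < 0 then v else u) = u :=
        fun m => if_neg (not_lt.2 m.2.1)
      simp_rw [this]
      change optionValue u _ = V
      rw [optionValue_mix, ← hV]
      simp only [smul_eq_mul]
      rw [show 1 - b = a by linarith]
      rfl
    · rw [optionValue_mix]
      have h3 := optionValue_le R v
      change _ ≤ (1 - b) * _ + b * optionValue v F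
      nlinarith
  · obtain ⟨a, ha⟩ := exists_threshold_value hF h h2
    exact ⟨fullSignal F, a, ha, optionValue_le R v⟩

theorem feasiblePayoffsWithin_subset (hF : F ≪ volume) {δ ε : ℝ} (hk : 0 < k)
    (hkm : k < priorMean F) (hn : 1 < n) (hε : ε < δ)
    (hδ : priorMean F - k + searchGain F (priorMean F - k) + δ ≤ mcCallPayoff F k + k ^ 2) :
    feasiblePayoffsWithin F n k ε ⊆ equilibriumPayoffs F n k := by
  rintro y ⟨⟨hy0, hyu, hysum⟩, hyε⟩
  obtain ⟨hc1, hc2, hc3⟩ := mcCallPayoff_spec hk hkm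
  have hμ1 := (priorMean_mem F).2
  set c := mcCallPayoff F k with hc
  set u := y (Fin.last n) with hu
  set s := ∑ i : Fin n, y i.castSucc with hs
  have hs0 : 0 ≤ s := Finset.sum_nonneg fun i _ => hy0 _
  rw [Fin.sum_univ_castSucc] at hysum
  unfold autarkyPayoff at hyu
  obtain ⟨R, hR1, hR2⟩ := exists_rare_disclosure (F := F) hk (by linarith) c hc2
  rw [hc1] at hR2
  have hfull : optionValue c F = c + k := by
    have := optionValue_full (F := F) c
    rwa [hc1] at this
  have hfull' : optionValue (priorMean F - k) F =
      priorMean F - k + searchGain F (priorMean F - k) := optionValue_full _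
  -- Since g(c) = k, rare disclosure adds k ^ 2 to c.
  have hRdet : optionValue (priorMean F - k) F + δ ≤ optionValue c (R : Measure unitInterval) := by
    rw [hfull']; nlinarith
  have hRc := optionValue_le R c
  obtain ⟨G, a, hGV, hGR⟩ := exists_signal_threshold hF (u := priorMean F - k) (v := c)
    (V := u + k + s) R (by rw [hR1]; linarith) (by rw [hfull]; linarith)
  obtain ⟨q, hq⟩ := exists_lottery hn (fun i : Fin n => y i.castSucc) fun i => hy0 _
  let S : Scheme F n :=
    { fee := fun z => match z with | .target => s.toNNReal | .reward => 0 | .punish => 0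
      sig := fun z => match z with | .target => G | .reward => fullSignal F | .punish => R
      -- Posterior means are always below 2 and never below 0, so when all brokers conform and the
      -- agent buys, these two phases perpetuate themselves.
      threshold := fun z => match z with | .target => a | .reward => 2 | .punish => 0
      lottery := q
      value := fun z => match z with | .target => u | .reward => c | .punish => priorMean F - k }
  have hsr : ((s.toNNReal : ℝ≥0) : ℝ) = s := Real.coe_toNNReal _ hs0
  have hS : S.IsIncentiveCompatible k :=
    { cost_pos := hk
      two_le := hn
      fee_reward := rfl
      fee_punish := rfl
      value_le_one := by
        rintro (_ | _ | _)
        · change u ≤ 1; linarith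
        · exact hc3
        · change priorMean F - k ≤ 1; linarith
      value_punish_nonneg := by change 0 ≤ priorMean F - k; linarith
      value_punish := sub_add_cancel _ _
      le_value := by
        rintro (_ | _ | _)
        · change _ ≤ u + k; linarith
        · change _ ≤ c + k; linarith
        · exact (sub_add_cancel _ _).ge
      value_eq := by
        rintro (_ | _ | _)
        · change _ = u + k + ((s.toNNReal : ℝ≥0) : ℝ)
          rw [hsr]; exact hGV
        · change ∫ m : unitInterval, max (m : ℝ) (if (m : ℝ) < 2 then c else priorMean F - k) ∂F =
            c + k + ((0 : ℝ≥0) : ℝ)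
          have : ∀ m : unitInterval, (if (m : ℝ) < 2 then c else priorMean F - k) = c :=
            fun m => if_pos (by linarith [m.2.2])
          simp_rw [this]
          rw [NNReal.coe_zero, add_zero]; exact hfull
        · change ∫ m : unitInterval, max (m : ℝ) (if (m : ℝ) < 0 then c else priorMean F - k)
            ∂(R : Measure unitInterval) = priorMean F - k + k + ((0 : ℝ≥0) : ℝ)
          have : ∀ m : unitInterval, (if (m : ℝ) < 0 then c else priorMean F - k)
              = priorMean F - k := fun m => if_neg (not_lt.2 m.2.1)
          simp_rw [this]
          rw [NNReal.coe_zero, add_zero, sub_add_cancel]; exact hR1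
      deterrence := by
        rintro (_ | _ | _)
        · change optionValue (priorMean F - k) F + ((s.toNNReal : ℝ≥0) : ℝ) < optionValue c G
          rw [hsr]; linarith
        · change optionValue (priorMean F - k) F + ((0 : ℝ≥0) : ℝ) < optionValue c F
          rw [NNReal.coe_zero]; linarith
        · change optionValue (priorMean F - k) F + ((0 : ℝ≥0) : ℝ) < optionValue c R
          rw [NNReal.coe_zero]; linarith }
  refine ⟨S.profile, hS.isEquilibrium, fun i => ?_, hS.agentPayoff_eq 0 _⟩
  rw [hS.brokerPayoff_eq]
  change ((q i * ((s.toNNReal : ℝ≥0) : ℝ≥0∞) : ℝ≥0∞) : EReal) = _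
  rw [hq i, EReal.coe_ennreal_ofReal, max_eq_left (hy0 _)]

omit [IsProbabilityMeasure F] in
theorem interior_feasiblePayoffsWithin_nonempty (hkm : k < priorMean F) {ε : ℝ} (hε : 0 < ε)
    (hlt : priorMean F - k < mcCallPayoff F k) :
    (interior (feasiblePayoffsWithin F n k ε)).Nonempty := by
  set U : Set (Fin (n + 1) → ℝ) := {y | (∀ j, 0 < y j) ∧ priorMean F - k < y (Fin.last n) ∧
    ∑ j, y j < mcCallPayoff F k ∧ ∑ i : Fin n, y i.castSucc < ε} with hU
  have hopen : IsOpen U := by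
    have h1 : IsOpen {y : Fin (n + 1) → ℝ | ∀ j, 0 < y j} := by
      have : {y : Fin (n + 1) → ℝ | ∀ j, 0 < y j} = ⋂ j, {y | 0 < y j} := by ext; simp
      rw [this]
      exact isOpen_iInter_of_finite fun j => isOpen_lt continuous_const (continuous_apply j)
    exact h1.inter ((isOpen_lt continuous_const (continuous_apply _)).inter
      ((isOpen_lt (f := fun y : Fin (n + 1) → ℝ => ∑ j, y j) (by fun_prop) continuous_const).inter
        (isOpen_lt (f := fun y : Fin (n + 1) → ℝ => ∑ i : Fin n, y i.castSucc) (by fun_prop)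
          continuous_const)))
  have hsub : U ⊆ feasiblePayoffsWithin F n k ε := fun y hy =>
    ⟨⟨fun j => (hy.1 j).le, hy.2.1.le, hy.2.2.1.le⟩, hy.2.2.2.le⟩
  set d := mcCallPayoff F k - (priorMean F - k) with hd
  set e := min ε d / 4 with he
  have hmin : 0 < min ε d := lt_min hε (by linarith)
  have hε' := min_le_left ε d
  have hd' := min_le_right ε d
  -- The brokers together get at most a quarter of both ε and d, so adding d / 2 for the agent stays
  -- strictly inside every constraint.
  set x : ℝ := e / (n + 1) with hx
  have hxpos : 0 < x := by positivity
  have hnx : n * x ≤ e := by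
    rw [hx, mul_div_assoc', div_le_iff₀ (by positivity)]
    have : 0 < e := by positivity
    nlinarith
  refine ⟨Fin.snoc (α := fun _ => ℝ) (fun _ => x) (priorMean F - k + d / 2),
    interior_maximal hsub hopen ⟨fun j => ?_, ?_, ?_, ?_⟩⟩
  · refine Fin.lastCases ?_ (fun i => ?_) j
    · rw [Fin.snoc_last]; linarith
    · rw [Fin.snoc_castSucc]; exact hxpos
  · rw [Fin.snoc_last]; linarith
  · rw [Fin.sum_univ_castSucc]
    simp only [Fin.snoc_castSucc, Fin.snoc_last, Finset.sum_const, Finset.card_univ,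
      Fintype.card_fin, nsmul_eq_mul]
    linarith
  · simp only [Fin.snoc_castSucc, Finset.sum_const, Finset.card_univ, Fintype.card_fin,
      nsmul_eq_mul]
    linarith

end Feasible

end PersuadedSearch
end

theorem proposition4 (F : MeasureTheory.Measure unitInterval)
    [MeasureTheory.IsProbabilityMeasure F] (hF : F ≪ MeasureTheory.volume) :
    ∃ kss : ℝ, PersuadedSearch.monopolyThreshold F < kss ∧ kss < PersuadedSearch.priorMean F ∧
      ∃ ε : ℝ, 0 < ε ∧ ∀ k : ℝ, 0 < k → k ≤ kss → ∀ n : ℕ, 1 < n →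
        PersuadedSearch.feasiblePayoffsWithin F n k ε ⊆
            PersuadedSearch.equilibriumPayoffs F n k ∧
          (interior (PersuadedSearch.feasiblePayoffsWithin F n k ε)).Nonempty := by
  obtain ⟨kss, h1, h2, δ, hδ, h3⟩ := PersuadedSearch.exists_cost_bound hF
    {κ : ℝ | 0 < κ ∧ κ < PersuadedSearch.priorMean F ∧
      ∀ k : ℝ, 0 < k → k ≤ κ →
        PersuadedSearch.equilibriumPayoffs F 1 k = PersuadedSearch.feasiblePayoffs F 1 k}
    (fun κ hκ => ⟨hκ.1, hκ.2.1, fun k hk hkκ =>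
      PersuadedSearch.le_of_equilibriumPayoffs_eq hk (hkκ.trans_lt hκ.2.1) (hκ.2.2 k hk hkκ)⟩)
  have hm : kss < PersuadedSearch.priorMean F :=
    h2.trans_le PersuadedSearch.searchGain_priorMean_le
  -- Halving δ leaves deterrence strict. The interior is nonempty because k ≤ g(μ) forces c ≥ μ > μ
  -- - k.
  refine ⟨kss, h1, hm, δ / 2, by positivity, fun k hk hkk n hn =>
    ⟨PersuadedSearch.feasiblePayoffsWithin_subset hF hk (hkk.trans_lt hm) hn (by linarith)
      (h3 k hk hkk),
    PersuadedSearch.interior_feasiblePayoffsWithin_nonempty (hkk.trans_lt hm) (by positivity) ?_⟩⟩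
  have := PersuadedSearch.le_mcCallPayoff hk (hkk.trans_lt hm) (hkk.trans h2.le)
  linarith
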